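/- **Setting.** Let $\mathsf H_1,\dots,\mathsf H_m$ and $\mathsf G_1,\dots,\mathsf G_p$ be separable real Hilbert spaces, with direct Hilbert sums $\mathbf H=\mathsf H_1\oplus\cdots\oplus\mathsf H_m$ and $\mathbf G=\mathsf G_1\oplus\cdots\oplus\mathsf G_p$, and let $(\Omega,\mathcal F,\mathsf P)$ be a probability space. For all $i\in\{1,\dots,m\}$ and $k\in\{1,\dots,p\}$, let $\mathsf A_i\colon\mathsf H_i\to2^{\mathsf H_i}$ and $\mathsf B_k\colon\mathsf G_k\to2^{\mathsf G_k}$ be maximally monotone and let $\mathsf L_{ki}\colon\mathsf H_i\to\mathsf G_k$ be linear and bounded. Set $\mathbf A\mathbf x=\mathsf A_1\mathsf x_1\times\cdots\times\mathsf A_m\mathsf x_m$, $\mathbf B\mathbf y=\mathsf B_1\mathsf y_1\times\cdots\times\mathsf B_p\mathsf y_p$, $\mathbf L\mathbf x=\big(\sum_{i=1}^m\mathsf L_{ki}\mathsf x_i\big)_{1\le k\le p}$ and $\mathbf L^*\mathbf v=\big(\sum_{k=1}^p\mathsf L_{ki}^*\mathsf v_k\big)_{1\le i\le m}$. Let $\mathbf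 F$ be the set of solutions of the primal problem $$\text{find }\mathbf x\in\mathbf H\text{ such that }\mathbf 0\in\mathbf A\mathbf x+\mathbf L^*\mathbf B(\mathbf L\mathbf x),$$ that is, $\mathbf x\in\mathbf F$ if and only if there is $\mathbf v\in\mathbf G$ such that $\mathsf v_k\in\mathsf B_k\big(\sum_j\mathsf L_{kj}\mathsf x_j\big)$ for every $k$ and $-\sum_k\mathsf L_{ki}^*\mathsf v_k\in\mathsf A_i\mathsf x_i$ for every $i$. Assume that $\mathbf F\neq\varnothing$. Let $\mathbf F^*$ be the set of solutions of the dual problem $$\text{find }\mathbf v\in\mathbf G\text{ such that }\mathbf 0\in-\mathbf L\mathbf A^{-1}(-\mathbf L^*\mathbf v)+\mathbf B^{-1}\mathbf v.$$ **Algorithm.** Let $\gamma\in\left]0,+\infty\right[$ and let $(\mu_n)_{n\in\mathbb N}$ be a sequence in $\left]0,2\right[$ with $\inf_n\mu_n>0$ and $\sup_n\mu_n<2$. Let $\mathbf x_0,\mathbf z_0,(\mathbf a_n)_{n\in\mathbb N},(\mathbf c_n)_{n\in\mathbb N}$ be $\mathbf H$-valued random variables, let $\mathbf y_0,\mathbf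 w_0,(\mathbf b_n)_{n\in\mathbb N},(\mathbf d_n)_{n\in\mathbb N}$ be $\mathbf G$-valued random variables, and let $(\boldsymbol\varepsilon_n)_{n\in\mathbb N}$ be identically distributed random variables with values in $\{0,1\}^{m+p}\setminus\{\mathbf 0\}$. Let $\mathbf V=\{(\mathbf x,\mathbf y)\in\mathbf H\oplus\mathbf G : \mathbf y=\mathbf L\mathbf x\}$, let $(\mathsf Q_j)_{1\le j\le m+p}$ be the components of the orthogonal projection operator onto $\mathbf V$ (so $\mathsf Q_i$ has values in $\mathsf H_i$ and $\mathsf Q_{m+k}$ in $\mathsf G_k$), and let $\mathsf J_{\mathsf M}=(\mathrm{Id}+\mathsf M)^{-1}$ denote the resolvent of $\mathsf M$. Suppose that, almost surely, for every $n\in\mathbb N$, $i\in\{1,\dots,m\}$ and $k\in\{1,\dots,p\}$, $$\begin{aligned} z_{i,n+1}&=z_{i,n}+\varepsilon_{i,n}\big(\mathsf Q_i(\mathbf x_n,\mathbf y_n)+c_{i,n}-z_{i,n}\big),\\ x_{i,n+1}&=x_{i,n}+\varepsilon_{i,n}\mu_n\big(\mathsf J_{\gamma\mathsf A_i}(2z_{i,n+1}-x_{i,n})+a_{i,n}-z_{i,n+1}\big),\\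 w_{k,n+1}&=w_{k,n}+\varepsilon_{m+k,n}\big(\mathsf Q_{m+k}(\mathbf x_n,\mathbf y_n)+d_{k,n}-w_{k,n}\big),\\ y_{k,n+1}&=y_{k,n}+\varepsilon_{m+k,n}\mu_n\big(\mathsf J_{\gamma\mathsf B_k}(2w_{k,n+1}-y_{k,n})+b_{k,n}-w_{k,n+1}\big), \end{aligned}$$ all iterates being random variables, and set $\mathcal Y_n=\sigma\big((\mathbf x_j,\mathbf y_j)_{0\le j\le n}\big)$. **Assumptions.** 1. Almost surely, $\sum_n\sqrt{\mathsf E(\|\mathbf a_n\|^2\mid\mathcal Y_n)}<+\infty$, $\sum_n\sqrt{\mathsf E(\|\mathbf b_n\|^2\mid\mathcal Y_n)}<+\infty$, $\sum_n\sqrt{\mathsf E(\|\mathbf c_n\|^2\mid\mathcal Y_n)}<+\infty$, $\sum_n\sqrt{\mathsf E(\|\mathbf d_n\|^2\mid\mathcal Y_n)}<+\infty$, $\mathbf c_n\rightharpoonup\mathbf 0$ and $\mathbf d_n\rightharpoonup\mathbf 0$. 2. For every $n\in\mathbb N$, $\sigma(\boldsymbol\varepsilon_n)$ and $\mathcal Y_n$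 are independent. 3. For every $j\in\{1,\dots,m+p\}$, $\mathsf P[\varepsilon_{j,0}=1]>0$. 4. For every $j\in\{1,\dots,m+p\}$, almost surely $\varepsilon_{j,n}=1$ for infinitely many $n$ (by Assumption 3 this is automatic when the $\boldsymbol\varepsilon_n$ are mutually independent). **Conclusion.** $(\mathbf z_n)_{n\in\mathbb N}$ converges weakly almost surely to an $\mathbf F$-valued random variable, and $\big(\gamma^{-1}(\mathbf w_n-\mathbf y_n)\big)_{n\in\mathbb N}$ converges weakly almost surely to an $\mathbf F^*$-valued random variable. -/

import Mathlib

open MeasureTheory ProbabilityTheory Filter Topology Set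
open scoped Pointwise ENNReal InnerProductSpace

noncomputable section

namespace BlockDR

/-! ### Set-valued operators on a real Hilbert space -/

section Operators

variable {E : Type*} [NormedAddCommGroup E] [InnerProductSpace ℝ E]

/-- A set-valued operator `A : E → 2^E` is monotone. -/
def IsMonotone (A : E → Set E) : Prop :=
  ∀ x y, ∀ u ∈ A x, ∀ v ∈ A y, 0 ≤ ⟪x - y, u - v⟫_ℝ

/-- `A` is maximally monotone: it is monotone, and no monotone operator has a strictly larger
graph. -/
def IsMaximallyMonotone (A : E → Set E) : Prop :=
  IsMonotone A ∧ ∀ A' : E → Set E, IsMonotone A' → (∀ x, A x ⊆ A' x) → A' = A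

/-- The inverse operator: `x ∈ A⁻¹ u` iff `u ∈ A x`. -/
def inverse {E F : Type*} (A : E → Set F) (u : F) : Set E := {x | u ∈ A x}

/-- The set-valued resolvent `(Id + A)⁻¹`. -/
def resolventSet (A : E → Set E) : E → Set E := inverse (fun p => {p} + A p)

open Classical in
/-- The resolvent `J_A = (Id + A)⁻¹` as a single-valued map. When `A` is maximally monotone,
`resolventSet A x` is a singleton for every `x`; the value `0` is used where it is empty. -/
def resolvent (A : E → Set E) (x : E) : E :=
  if h : (resolventSet A x).Nonempty then h.some else 0

end Operators

/-! ### Direct Hilbert sums, block operators -/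

section Blocks

/-- The product operator `x ↦ A₁ x₁ × ⋯ × Aₙ xₙ` on a direct Hilbert sum. -/
def prodOp {ι : Type*} {E : ι → Type*} (A : ∀ i, E i → Set (E i))
    (x : PiLp 2 E) : Set (PiLp 2 E) :=
  {u | ∀ i, u i ∈ A i (x i)}

variable {m p : ℕ} {H : Fin m → Type*} {G : Fin p → Type*}
  [∀ i, NormedAddCommGroup (H i)] [∀ i, InnerProductSpace ℝ (H i)]
  [∀ k, NormedAddCommGroup (G k)] [∀ k, InnerProductSpace ℝ (G k)]

/-- The block operator `L : x ↦ (∑ i, L k i (x i))ₖ`. -/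
def blockOp (L : ∀ k i, H i →L[ℝ] G k) (x : PiLp 2 H) : PiLp 2 G :=
  WithLp.toLp 2 fun k => ∑ i, L k i (x i)

/-- The adjoint block operator `L* : v ↦ (∑ k, (L k i)* (v k))ᵢ`. -/
def blockAdjoint [∀ i, CompleteSpace (H i)] [∀ k, CompleteSpace (G k)]
    (L : ∀ k i, H i →L[ℝ] G k) : PiLp 2 G → PiLp 2 H :=
  blockOp fun i k => ContinuousLinearMap.adjoint (L k i)

/-- Solutions of the primal inclusion `0 ∈ A x + L* (B (L x))`. -/
def primalSolutions [∀ i, CompleteSpace (H i)] [∀ k, CompleteSpace (G k)]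
    (A : ∀ i, H i → Set (H i)) (B : ∀ k, G k → Set (G k)) (L : ∀ k i, H i →L[ℝ] G k) :
    Set (PiLp 2 H) :=
  {x | 0 ∈ prodOp A x + blockAdjoint L '' prodOp B (blockOp L x)}

/-- Solutions of the dual inclusion `0 ∈ -L (A⁻¹ (-L* v)) + B⁻¹ v`. -/
def dualSolutions [∀ i, CompleteSpace (H i)] [∀ k, CompleteSpace (G k)]
    (A : ∀ i, H i → Set (H i)) (B : ∀ k, G k → Set (G k)) (L : ∀ k i, H i →L[ℝ] G k) :
    Set (PiLp 2 G) :=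
  {v | 0 ∈ -(blockOp L '' inverse (prodOp A) (-(blockAdjoint L v))) + inverse (prodOp B) v}

/-- The subspace `V = {(x, y) ∈ H ⊕ G | ∀ k, y k = ∑ i, L k i (x i)}`. -/
def graphSubspace (L : ∀ k i, H i →L[ℝ] G k) : Submodule ℝ (WithLp 2 (PiLp 2 H × PiLp 2 G)) where
  carrier := {q | ∀ k, q.snd k = ∑ i, L k i (q.fst i)}
  add_mem' := by
    intro a b ha hb k
    simp [ha k, hb k, Finset.sum_add_distrib]
  zero_mem' := by
    intro k
    simp
  smul_mem' := by
    intro c a ha k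
    simp [ha k, Finset.smul_sum]

instance [∀ i, CompleteSpace (H i)] [∀ k, CompleteSpace (G k)] (L : ∀ k i, H i →L[ℝ] G k) :
    (graphSubspace L).HasOrthogonalProjection := by
  have hc : IsClosed (graphSubspace L : Set (WithLp 2 (PiLp 2 H × PiLp 2 G))) := by
    have : (graphSubspace L : Set (WithLp 2 (PiLp 2 H × PiLp 2 G))) =
        ⋂ k, {q | q.snd k = ∑ i, L k i (q.fst i)} := by
      ext q
      simp only [Set.mem_iInter, Set.mem_ofPred_eq]
      exact Iff.rfl
    rw [this]
    refine isClosed_iInter fun k => isClosed_eq ?_ ?_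
    · fun_prop
    · fun_prop
  have : CompleteSpace (graphSubspace L) := hc.completeSpace_coe
  infer_instance

/-- The orthogonal projection of `(x, y)` onto `V`; its components are the operators `Q_j`. -/
def graphProj [∀ i, CompleteSpace (H i)] [∀ k, CompleteSpace (G k)] (L : ∀ k i, H i →L[ℝ] G k)
    (x : PiLp 2 H) (y : PiLp 2 G) : WithLp 2 (PiLp 2 H × PiLp 2 G) :=
  (graphSubspace L).starProjection (WithLp.toLp 2 (x, y))

end Blocks

/-! ### Probabilistic notions -/

/-- The set `D = {0,1}^{m+p} \ {0}` of activation patterns; `Sum.inl i` is the index `i` and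
`Sum.inr k` the index `m + k`. -/
abbrev Pattern (m p : ℕ) : Type := {e : Fin m ⊕ Fin p → Fin 2 // e ≠ 0}

/-- The component `e_j ∈ {0,1}` of an activation pattern, as a real number. -/
def Pattern.coeff {m p : ℕ} (e : Pattern m p) (j : Fin m ⊕ Fin p) : ℝ := ((e.1 j : ℕ) : ℝ)

/-- The σ-algebra `σ((x_j, y_j) : 0 ≤ j ≤ n)`. -/
abbrev history {Ω E F : Type*} [MeasurableSpace E] [MeasurableSpace F]
    (x : ℕ → Ω → E) (y : ℕ → Ω → F) (n : ℕ) : MeasurableSpace Ω :=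
  ⨆ j ∈ Finset.range (n + 1),
    (MeasurableSpace.comap (x j) inferInstance ⊔ MeasurableSpace.comap (y j) inferInstance)

/-- `∑ₙ √(E[‖aₙ‖² | 𝓨ₙ]) < +∞` almost surely, with the `[0,+∞]`-valued conditional expectation. -/
def SummableErrors {Ω E : Type*} [MeasurableSpace Ω] [NormedAddCommGroup E] (P : Measure Ω)
    (Y : ℕ → MeasurableSpace Ω) (a : ℕ → Ω → E) : Prop :=
  ∀ᵐ ω ∂P, ∑' n, (condLExp (Y n) P (fun ω' => ‖a n ω'‖ₑ ^ 2) ω) ^ (1 / 2 : ℝ) < ∞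

/-- Weak convergence of a sequence in a real normed space. -/
def WeakTendsto {E : Type*} [NormedAddCommGroup E] [NormedSpace ℝ E] (u : ℕ → E) (l : E) : Prop :=
  Tendsto (fun n => toWeakSpace ℝ E (u n)) atTop (𝓝 (toWeakSpace ℝ E l))

/-- `(uₙ)` converges weakly almost surely to an `S`-valued random variable. -/
def WeaklyConvergesTo {Ω E : Type*} [MeasurableSpace Ω] [NormedAddCommGroup E] [NormedSpace ℝ E]
    [MeasurableSpace E] (P : Measure Ω) (u : ℕ → Ω → E) (S : Set E) : Prop :=
  ∃ l : Ω → E, Measurable l ∧ (∀ ω, l ω ∈ S) ∧ ∀ᵐ ω ∂P, WeakTendsto (fun n => u n ω) (l ω)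

end BlockDR

end

namespace BlockDR

/-! On the product space `H ⊕ G` the primal inclusion asks for a zero of `A × B` plus the normal
cone of the graph `V` of `L`. Since `Vᗮ` consists of the vectors `(-L* v, v)`, a Kuhn–Tucker pair
`(x, v)` is the same thing as a point `q = (x, L x)` of `V` with a vector of `Vᗮ` in `(A × B) q`.
The Douglas–Rachford operator `T = drOp V J`, with `J` the resolvent of `γ (A × B)` and `Q` the
projection onto `V`, is firmly nonexpansive. If `T X = X`, then `Q X` carries a primal solution and
`γ⁻¹ (Q X - X)` a dual one (`dual_pair_of_drOp_eq`).

The sequence `X n = (x n, y n)` is an inexact relaxed iteration of `T` in which only randomly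
selected blocks are updated. Weighting the squared distance in block `j` by the inverse of its
activation probability makes the conditional mean of one random step behave like a full
deterministic step, up to summable errors (`lintegral_block_le`). By `robbins_siegmund`, the
weighted distance to each fixed point converges and `‖T (X n) - X n‖ ^ 2` is summable, almost
surely. A countable dense set of fixed points permits a single null set, and Opial's argument
(`exists_weak_limit_of_fejer`) gives weak convergence of `X n` to a fixed point `l`.

As `Q` is weakly continuous, `Q (X n)` converges weakly to `Q l`. The blocks of `z` and `w` are
refreshed from it infinitely often, up to weakly null errors, and so have the same limits.
Separability makes the weak limits measurable. -/

theorem mem_resolventSet_iff {E : Type*} [NormedAddCommGroup E] {A : E → Set E} {w x : E} :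
    x ∈ resolventSet A w ↔ w - x ∈ A x := by
  constructor
  · intro h
    obtain ⟨_, rfl, v, hv, rfl⟩ := Set.mem_add.1 h
    simpa using hv
  · intro h
    exact Set.mem_add.2 ⟨x, rfl, _, h, by abel⟩

/-! ### Minty's theorem and resolvents of maximally monotone operators. -/

section Hilbert

variable {E : Type*} [NormedAddCommGroup E] [InnerProductSpace ℝ E]

/-- A family of vectors bounded along an ultrafilter has a weak limit along it. -/
theorem exists_weak_limit [CompleteSpace E] {ι : Type*} (U : Ultrafilter ι) (u : ι → E) (C : ℝ)
    (hu : ∀ᶠ i in (U : Filter ι), ‖u i‖ ≤ C) :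
    ∃ l : E, ∀ y : E, Tendsto (fun i => ⟪u i, y⟫_ℝ) U (𝓝 ⟪l, y⟫_ℝ) := by
  have h1 : ∀ y : E, ∃ r ∈ Icc (-(C * ‖y‖)) (C * ‖y‖),
      Tendsto (fun i => ⟪u i, y⟫_ℝ) U (𝓝 r) := by
    intro y
    have hb : ∀ᶠ i in (U : Filter ι), ⟪u i, y⟫_ℝ ∈ Icc (-(C * ‖y‖)) (C * ‖y‖) := by
      filter_upwards [hu] with i hi
      have := abs_le.1 ((abs_real_inner_le_norm (u i) y).trans
        (mul_le_mul_of_nonneg_right hi (norm_nonneg y)))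
      exact this
    obtain ⟨r, hr, hle⟩ := (isCompact_Icc (a := -(C * ‖y‖)) (b := C * ‖y‖)).ultrafilter_le_nhds
      (U.map fun i => ⟪u i, y⟫_ℝ) (le_principal_iff.2 hb)
    exact ⟨r, hr, hle⟩
  choose φ hφ hlim using h1
  -- Uniqueness of limits makes the scalar limits linear in `y`; Riesz representation turns them
  -- into a vector.
  let f : E →ₗ[ℝ] ℝ :=
    { toFun := φ
      map_add' := fun y z => tendsto_nhds_unique (hlim (y + z))
        (by simpa only [inner_add_right] using (hlim y).add (hlim z))
      map_smul' := fun c y => tendsto_nhds_unique (hlim (c • y))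
        (by simpa only [inner_smul_right, RingHom.id_apply, smul_eq_mul] using
          (hlim y).const_mul c) }
  let F : E →L[ℝ] ℝ := f.mkContinuous C fun y => abs_le.2 (hφ y)
  refine ⟨(InnerProductSpace.toDual ℝ E).symm F, fun y => ?_⟩
  rw [InnerProductSpace.toDual_symm_apply]
  exact hlim y

/-- The convex combination of the functions `x ↦ ⟪x - yᵢ, x + vᵢ⟫` attached to a monotone family
takes a nonpositive value. -/
theorem exists_sum_inner_nonpos {ι : Type*} [Fintype ι] (y v : ι → E)
    (hmono : ∀ i j, 0 ≤ ⟪y i - y j, v i - v j⟫_ℝ) (c : ι → ℝ) (hc : ∀ i, 0 ≤ c i)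
    (hsum : ∑ i, c i = 1) : ∃ x : E, ∑ i, c i * ⟪x - y i, x + v i⟫_ℝ ≤ 0 := by
  set Y := ∑ i, c i • y i with hY
  set V := ∑ i, c i • v i with hV
  have key : ∀ x : E, ∑ i, c i * ⟪x - y i, x + v i⟫_ℝ
      = ⟪x, x⟫_ℝ + ⟪x, V⟫_ℝ - ⟪Y, x⟫_ℝ - ∑ i, c i * ⟪y i, v i⟫_ℝ := by
    intro x
    have : ∀ i, c i * ⟪x - y i, x + v i⟫_ℝ = c i * ⟪x, x⟫_ℝ + ⟪x, c i • v i⟫_ℝ - ⟪c i • y i, x⟫_ℝ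
        - c i * ⟪y i, v i⟫_ℝ := by
      intro i
      simp only [inner_sub_left, inner_add_right, real_inner_smul_left, real_inner_smul_right]
      ring
    simp only [this, Finset.sum_sub_distrib, Finset.sum_add_distrib, ← Finset.sum_mul, hsum,
      one_mul, ← inner_sum, ← sum_inner, hY, hV]
  -- A Chebyshev-type inequality: average the monotonicity relation over all pairs with weights `c i
  -- * c j`.
  have hcross : ⟪Y, V⟫_ℝ ≤ ∑ i, c i * ⟪y i, v i⟫_ℝ := by
    have h1 : ∑ i, c i * ∑ j, c j * ⟪y i - y j, v i - v j⟫_ℝ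
        = 2 * ∑ i, c i * ⟪y i, v i⟫_ℝ - 2 * ⟪Y, V⟫_ℝ := by
      have h2 : ∀ i, ∑ j, c j * ⟪y i - y j, v i - v j⟫_ℝ
          = ⟪y i, v i⟫_ℝ - ⟪y i, V⟫_ℝ - ⟪Y, v i⟫_ℝ + ∑ j, c j * ⟪y j, v j⟫_ℝ := by
        intro i
        have : ∀ j, c j * ⟪y i - y j, v i - v j⟫_ℝ = c j * ⟪y i, v i⟫_ℝ - ⟪y i, c j • v j⟫_ℝ
            - ⟪c j • y j, v i⟫_ℝ + c j * ⟪y j, v j⟫_ℝ := by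
          intro j
          simp only [inner_sub_left, inner_sub_right, real_inner_smul_left, real_inner_smul_right]
          ring
        simp only [this, Finset.sum_sub_distrib, Finset.sum_add_distrib, ← Finset.sum_mul, hsum,
          one_mul, ← inner_sum, ← sum_inner, hY, hV]
      have h3 : ∀ i, c i * ∑ j, c j * ⟪y i - y j, v i - v j⟫_ℝ
          = c i * ⟪y i, v i⟫_ℝ - ⟪c i • y i, V⟫_ℝ - ⟪Y, c i • v i⟫_ℝ
            + c i * ∑ j, c j * ⟪y j, v j⟫_ℝ := by
        intro i
        rw [h2, real_inner_smul_left, real_inner_smul_right]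
        ring
      simp only [h3, Finset.sum_sub_distrib, Finset.sum_add_distrib, ← Finset.sum_mul, hsum,
        one_mul, ← inner_sum, ← sum_inner, ← hY, ← hV]
      ring
    have h4 : 0 ≤ ∑ i, c i * ∑ j, c j * ⟪y i - y j, v i - v j⟫_ℝ :=
      Finset.sum_nonneg fun i _ => mul_nonneg (hc i) <| Finset.sum_nonneg fun j _ =>
        mul_nonneg (hc j) (hmono i j)
    linarith
  -- This minimizes the quadratic of `key`; by `hcross` the minimum is at most `-‖Y + V‖ ^ 2 / 4`.
  refine ⟨(1 / 2 : ℝ) • (Y - V), ?_⟩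
  rw [key]
  have h5 : 0 ≤ ⟪Y + V, Y + V⟫_ℝ := real_inner_self_nonneg
  simp only [inner_sub_left, inner_sub_right, inner_add_left, inner_add_right,
    real_inner_smul_left, real_inner_smul_right, real_inner_comm Y V] at h5 ⊢
  linarith

/-- The balls `{x | ⟪x - yᵢ, x + vᵢ⟫ ≤ 0}` attached to a finite monotone family almost
intersect. -/
theorem exists_inner_lt_of_monotone {ι : Type*} [Fintype ι] (y v : ι → E)
    (hmono : ∀ i j, 0 ≤ ⟪y i - y j, v i - v j⟫_ℝ) {δ : ℝ} (hδ : 0 < δ) :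
    ∃ x : E, ∀ i, ⟪x - y i, x + v i⟫_ℝ < δ := by
  classical
  by_contra hcon
  -- A minimax argument by separation: `D` is open, convex and upward closed, and failure of the
  -- claim means that the constant vector `δ` lies outside it.
  let D : Set (ι → ℝ) := {t | ∃ x : E, ∀ i, ⟪x - y i, x + v i⟫_ℝ < t i}
  have hD_open : IsOpen D := by
    have : D = ⋃ x : E, ⋂ i, {t | ⟪x - y i, x + v i⟫_ℝ < t i} := by
      ext t; simp [D]
    rw [this]
    exact isOpen_iUnion fun x => isOpen_iInter_of_finite fun i =>
      isOpen_lt continuous_const (continuous_apply i)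
  have hD_convex : Convex ℝ D := by
    rintro t ⟨x, hx⟩ t' ⟨x', hx'⟩ a b ha hb hab
    refine ⟨a • x + b • x', fun i => ?_⟩
    have hb' : b = 1 - a := by linarith
    have hid : ⟪(a • x + b • x') - y i, (a • x + b • x') + v i⟫_ℝ
        = a * ⟪x - y i, x + v i⟫_ℝ + b * ⟪x' - y i, x' + v i⟫_ℝ - a * b * ⟪x - x', x - x'⟫_ℝ := by
      subst hb'
      simp only [inner_sub_left, inner_sub_right, inner_add_left, inner_add_right,
        real_inner_smul_left, real_inner_smul_right, real_inner_comm x x']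
      ring
    have h0 : 0 ≤ a * b * ⟪x - x', x - x'⟫_ℝ :=
      mul_nonneg (mul_nonneg ha hb) real_inner_self_nonneg
    rw [hid]
    simp only [Pi.add_apply, Pi.smul_apply, smul_eq_mul]
    rcases ha.eq_or_lt with rfl | ha'
    · have : b = 1 := by linarith
      subst this
      have := hx' i
      linarith
    · have h1 := mul_lt_mul_of_pos_left (hx i) ha'
      have h2 := mul_le_mul_of_nonneg_left (hx' i).le hb
      linarith
  have hnot : (fun _ => δ : ι → ℝ) ∉ D := fun ⟨x, hx⟩ => hcon ⟨x, hx⟩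
  obtain ⟨f, hf⟩ := geometric_hahn_banach_open_point hD_convex hD_open hnot
  have hrep : ∀ t : ι → ℝ, f t = ∑ i, t i * f (Pi.single i 1) := by
    intro t
    conv_lhs => rw [← Finset.univ_sum_single t]
    rw [map_sum]
    refine Finset.sum_congr rfl fun i _ => ?_
    have : (Pi.single i (t i) : ι → ℝ) = t i • Pi.single i 1 := by
      rw [← Pi.single_smul, smul_eq_mul, mul_one]
    rw [this, map_smul, smul_eq_mul]
  let t₀ : ι → ℝ := fun i => ⟪(0 : E) - y i, 0 + v i⟫_ℝ + 1
  have ht₀ : t₀ ∈ D := ⟨0, fun i => lt_add_one _⟩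
  -- Raising one coordinate stays in `D`, where `f` is bounded above, so no coefficient of `f` is
  -- positive.
  have hneg : ∀ i, f (Pi.single i 1) ≤ 0 := by
    intro i
    by_contra hpos
    push Not at hpos
    obtain ⟨r, hr0, hr⟩ : ∃ r : ℝ, 0 ≤ r ∧ f (fun _ => δ) < f t₀ + r * f (Pi.single i 1) := by
      refine ⟨(|f (fun _ => δ) - f t₀| + 1) / f (Pi.single i 1), by positivity, ?_⟩
      rw [div_mul_cancel₀ _ hpos.ne']
      have := le_abs_self (f (fun _ => δ) - f t₀)
      linarith
    have hmem : t₀ + r • Pi.single i (1 : ℝ) ∈ D := by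
      refine ⟨0, fun j => ?_⟩
      have : 0 ≤ r * (Pi.single i (1 : ℝ) : ι → ℝ) j := by
        refine mul_nonneg hr0 ?_
        by_cases h : j = i
        · subst h; simp
        · simp [h]
      simp only [t₀, Pi.add_apply, Pi.smul_apply, smul_eq_mul]
      linarith
    have := hf _ hmem
    rw [map_add, map_smul, smul_eq_mul] at this
    linarith
  set Λ := ∑ i, -f (Pi.single i 1) with hΛ
  have hΛ0 : 0 < Λ := by
    refine lt_of_le_of_ne (Finset.sum_nonneg fun i _ => neg_nonneg.2 (hneg i)) fun h => ?_
    have hz := (Finset.sum_eq_zero_iff_of_nonneg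
      (fun i _ => neg_nonneg.2 (hneg i))).1 h.symm
    have : ∀ t, f t = 0 := fun t => by
      rw [hrep]
      exact Finset.sum_eq_zero fun i hi => by rw [neg_eq_zero.1 (hz i hi), mul_zero]
    have hlt := hf _ ht₀
    rw [this, this] at hlt
    exact lt_irrefl _ hlt
  obtain ⟨x, hx⟩ := exists_sum_inner_nonpos y v hmono (fun i => -f (Pi.single i 1) / Λ)
    (fun i => div_nonneg (neg_nonneg.2 (hneg i)) hΛ0.le)
    (by rw [← Finset.sum_div, ← hΛ, div_self hΛ0.ne'])
  -- The weighted mean at this `x` is nonpositive, so `f` is at least `-(δ / 2) * Λ` here, against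
  -- the value `-δ * Λ` at the separated point.
  have hlt := hf (fun i => ⟪x - y i, x + v i⟫_ℝ + δ / 2) ⟨x, fun i => by linarith⟩
  rw [hrep, hrep (fun _ => δ)] at hlt
  have e1 : ∑ i, (⟪x - y i, x + v i⟫_ℝ + δ / 2) * f (Pi.single i 1)
      = -(Λ * ∑ i, -f (Pi.single i 1) / Λ * ⟪x - y i, x + v i⟫_ℝ) - δ / 2 * Λ := by
    rw [Finset.mul_sum, hΛ, Finset.mul_sum, ← Finset.sum_neg_distrib, ← Finset.sum_sub_distrib]
    refine Finset.sum_congr rfl fun i _ => ?_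
    rw [← hΛ]
    field_simp
    ring
  have e2 : ∑ i, δ * f (Pi.single i 1) = -(δ * Λ) := by
    rw [hΛ, Finset.mul_sum, ← Finset.sum_neg_distrib]
    exact Finset.sum_congr rfl fun i _ => by ring
  rw [e1, e2] at hlt
  have := mul_nonpos_of_nonneg_of_nonpos hΛ0.le hx
  have := mul_pos hδ hΛ0
  linarith

/-- A monotone graph admits a point in the intersection of all its balls. -/
theorem exists_inner_nonpos_of_isMonotone [CompleteSpace E] {A : E → Set E} (hA : IsMonotone A) :
    ∃ x : E, ∀ y, ∀ v ∈ A y, ⟪x - y, x + v⟫_ℝ ≤ 0 := by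
  classical
  let Γ := {a : E × E // a.2 ∈ A a.1}
  rcases isEmpty_or_nonempty Γ with hΓ | ⟨⟨a₀⟩⟩
  · exact ⟨0, fun y v hv => (hΓ.false ⟨(y, v), hv⟩).elim⟩
  have hfin : ∀ q : Finset Γ × ℕ, ∃ x : E, ∀ a ∈ q.1,
      ⟪x - a.1.1, x + a.1.2⟫_ℝ < 1 / ((q.2 : ℝ) + 1) := by
    intro q
    obtain ⟨x, hx⟩ := exists_inner_lt_of_monotone (ι := q.1) (fun a => a.1.1.1) (fun a => a.1.1.2)
      (fun a b => hA _ _ _ a.1.2 _ b.1.2) (δ := 1 / ((q.2 : ℝ) + 1)) (by positivity)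
    exact ⟨x, fun a ha => hx ⟨a, ha⟩⟩
  choose u hu using hfin
  -- Along `U` every point of the graph is eventually taken into account and the tolerance tends to
  -- zero.
  let U : Ultrafilter (Finset Γ × ℕ) := Ultrafilter.of atTop
  have hUle : (U : Filter (Finset Γ × ℕ)) ≤ atTop := Ultrafilter.of_le atTop
  have hmem : ∀ a : Γ, ∀ᶠ q in (U : Filter (Finset Γ × ℕ)), a ∈ q.1 := by
    intro a
    refine hUle ((eventually_ge_atTop (({a} : Finset Γ), 0)).mono fun q hq => ?_)
    exact hq.1 (Finset.mem_singleton_self a)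
  have hsnd : Tendsto (fun q : Finset Γ × ℕ => 1 / ((q.2 : ℝ) + 1)) U (𝓝 0) :=
    (tendsto_one_div_add_atTop_nhds_zero_nat.comp
      (by rw [← prod_atTop_atTop_eq]; exact tendsto_snd)).mono_left hUle
  -- A single one of the balls, enlarged by a tolerance at most `1`, already bounds the approximate
  -- solutions.
  have hbound : ∃ C, ∀ᶠ q in (U : Filter (Finset Γ × ℕ)), ‖u q‖ ≤ C := by
    obtain ⟨⟨y, v⟩, hv⟩ := a₀
    refine ⟨‖y‖ + ‖v‖ + (‖y‖ * ‖v‖ + 1) + 1, (hmem ⟨(y, v), hv⟩).mono fun q hq => ?_⟩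
    have h1 := hu q _ hq
    have h2 : 1 / ((q.2 : ℝ) + 1) ≤ 1 := by
      rw [div_le_one (by positivity)]; linarith [q.2.cast_nonneg (α := ℝ)]
    simp only [inner_sub_left, inner_add_right, real_inner_self_eq_norm_sq] at h1
    have h3 := neg_le_of_abs_le (abs_real_inner_le_norm (u q) v)
    have h4 := le_of_abs_le (abs_real_inner_le_norm y (u q))
    have h5 := le_of_abs_le (abs_real_inner_le_norm y v)
    by_contra hlt
    push Not at hlt
    have := norm_nonneg y
    have := norm_nonneg v
    have := mul_nonneg (norm_nonneg y) (norm_nonneg v)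
    nlinarith [norm_nonneg (u q)]
  obtain ⟨C, hC⟩ := hbound
  obtain ⟨l, hl⟩ := exists_weak_limit U u C hC
  refine ⟨l, fun y v hv => ?_⟩
  -- The term `‖u q‖ ^ 2` is only weakly lower semicontinuous; it is replaced by its weakly
  -- continuous minorant `2 * ⟪u q, l⟫ - ‖l‖ ^ 2`.
  have hlow : Tendsto (fun q => 2 * ⟪u q, l⟫_ℝ - ⟪l, l⟫_ℝ + ⟪u q, v⟫_ℝ - ⟪u q, y⟫_ℝ - ⟪y, v⟫_ℝ) U
      (𝓝 (2 * ⟪l, l⟫_ℝ - ⟪l, l⟫_ℝ + ⟪l, v⟫_ℝ - ⟪l, y⟫_ℝ - ⟪y, v⟫_ℝ)) :=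
    (((((hl l).const_mul 2).sub_const _).add (hl v)).sub (hl y)).sub_const _
  have hle := le_of_tendsto_of_tendsto hlow hsnd <| (hmem ⟨(y, v), hv⟩).mono fun q hq => by
    have h1 := (hu q _ hq).le
    have h2 : 0 ≤ ⟪u q - l, u q - l⟫_ℝ := real_inner_self_nonneg
    simp only [inner_sub_left, inner_sub_right, inner_add_right, real_inner_comm l (u q),
      real_inner_comm (u q) y] at h1 h2 ⊢
    linarith
  simp only [inner_sub_left, inner_add_right, real_inner_comm l y]
  linarith

/-- Minty's theorem: a maximally monotone operator `A` satisfies `ran (Id + A) = E`. -/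
theorem IsMaximallyMonotone.resolventSet_nonempty [CompleteSpace E] {A : E → Set E}
    (hA : IsMaximallyMonotone A) (w : E) : (resolventSet A w).Nonempty := by
  let A₁ : E → Set E := fun y => {v | v + w ∈ A y}
  have hA₁ : IsMonotone A₁ := by
    intro y z v hv v' hv'
    simpa using hA.1 y z _ hv _ hv'
  obtain ⟨x, hx⟩ := exists_inner_nonpos_of_isMonotone hA₁
  -- After translation by `w`, the ball inequalities say that `(x, w - x)` is monotonically related
  -- to the whole graph of `A`; adding it preserves monotonicity, so maximality puts it in the
  -- graph.
  let A' : E → Set E := fun y => A y ∪ {v | y = x ∧ v = w - x}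
  have hkey : ∀ y, ∀ v ∈ A y, 0 ≤ ⟪y - x, v - (w - x)⟫_ℝ := by
    intro y v hv
    have := hx y (v - w) (by simpa [A₁] using hv)
    have e : ⟪y - x, v - (w - x)⟫_ℝ = -⟪x - y, x + (v - w)⟫_ℝ := by
      rw [← inner_neg_left]; congr 1 <;> abel
    linarith
  have hmono : IsMonotone A' := by
    rintro y z v (hv | ⟨rfl, rfl⟩) v' (hv' | ⟨rfl, rfl⟩)
    · exact hA.1 _ _ _ hv _ hv'
    · exact hkey _ _ hv
    · have := hkey _ _ hv'
      rw [← inner_neg_neg]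
      simpa using this
    · simp
  have heq := hA.2 A' hmono fun y => subset_union_left
  refine ⟨x, ?_⟩
  have hmem : w - x ∈ A x := by
    rw [← heq]; exact Or.inr ⟨rfl, rfl⟩
  exact Set.mem_add.2 ⟨x, rfl, w - x, hmem, by abel⟩

theorem IsMaximallyMonotone.smul {A : E → Set E} (hA : IsMaximallyMonotone A) {γ : ℝ}
    (hγ : 0 < γ) : IsMaximallyMonotone fun t => γ • A t := by
  constructor
  · rintro x y _ ⟨u, hu, rfl⟩ _ ⟨v, hv, rfl⟩
    simp only [← smul_sub, real_inner_smul_right]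
    exact mul_nonneg hγ.le (hA.1 _ _ _ hu _ hv)
  · intro A' hA' hsub
    have h := hA.2 (fun t => γ⁻¹ • A' t)
      (by
        rintro x y _ ⟨u, hu, rfl⟩ _ ⟨v, hv, rfl⟩
        simp only [← smul_sub, real_inner_smul_right]
        exact mul_nonneg (inv_nonneg.2 hγ.le) (hA' _ _ _ hu _ hv))
      fun t u hu => ⟨γ • u, hsub t (smul_mem_smul_set hu), by simp [hγ.ne']⟩
    funext t
    rw [← h]
    simp [smul_smul, hγ.ne']

/-- Minty's theorem rules out the default value `0` in `resolvent`. -/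
theorem IsMaximallyMonotone.sub_resolvent_mem [CompleteSpace E] {A : E → Set E}
    (hA : IsMaximallyMonotone A) (w : E) : w - resolvent A w ∈ A (resolvent A w) := by
  rw [resolvent, dif_pos (hA.resolventSet_nonempty w)]
  exact mem_resolventSet_iff.1 (hA.resolventSet_nonempty w).some_mem

/-- The resolvent of a maximally monotone operator is firmly nonexpansive. -/
theorem IsMaximallyMonotone.resolvent_firm [CompleteSpace E] {A : E → Set E}
    (hA : IsMaximallyMonotone A) (w w' : E) :
    ‖resolvent A w - resolvent A w'‖ ^ 2 ≤ ⟪resolvent A w - resolvent A w', w - w'⟫_ℝ := by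
  have h := hA.1 _ _ _ (hA.sub_resolvent_mem w) _ (hA.sub_resolvent_mem w')
  have e : w - resolvent A w - (w' - resolvent A w')
      = (w - w') - (resolvent A w - resolvent A w') := by abel
  rw [e, inner_sub_right, real_inner_self_eq_norm_sq] at h
  linarith

theorem IsMaximallyMonotone.resolvent_nonexpansive [CompleteSpace E] {A : E → Set E}
    (hA : IsMaximallyMonotone A) (w w' : E) :
    ‖resolvent A w - resolvent A w'‖ ≤ ‖w - w'‖ := by
  have h := (hA.resolvent_firm w w').trans (real_inner_le_norm _ _)
  by_contra! hlt
  nlinarith [norm_nonneg (w - w')]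

/-- Monotonicity applied to two candidate values bounds minus their squared distance below by zero,
so the chosen value is the only one. -/
theorem IsMaximallyMonotone.resolvent_eq [CompleteSpace E] {A : E → Set E}
    (hA : IsMaximallyMonotone A) {w x : E} (h : w - x ∈ A x) : resolvent A w = x := by
  have h := hA.1 _ _ _ (hA.sub_resolvent_mem w) _ h
  have e : w - resolvent A w - (w - x) = -(resolvent A w - x) := by abel
  rw [e, inner_neg_right, real_inner_self_eq_norm_sq] at h
  have : ‖resolvent A w - x‖ = 0 := by nlinarith [norm_nonneg (resolvent A w - x)]
  exact sub_eq_zero.1 (norm_eq_zero.1 this)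

end Hilbert

/-! ### Firmly nonexpansive maps, Opial's lemma and the Douglas–Rachford operator. -/

section FirmlyNonexpansive

variable {K : Type*} [NormedAddCommGroup K] [InnerProductSpace ℝ K]

/-- A firmly nonexpansive map. -/
def IsFirm (T : K → K) : Prop :=
  ∀ u v, ‖T u - T v‖ ^ 2 ≤ ⟪T u - T v, u - v⟫_ℝ

theorem IsFirm.nonexpansive {T : K → K} (hT : IsFirm T) (u v : K) : ‖T u - T v‖ ≤ ‖u - v‖ := by
  have h := (hT u v).trans (real_inner_le_norm _ _)
  by_contra! hlt
  nlinarith [norm_nonneg (u - v)]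

theorem IsFirm.continuous {T : K → K} (hT : IsFirm T) : Continuous T :=
  (LipschitzWith.of_dist_le_mul (K := 1) fun u v => by
    simpa [dist_eq_norm] using hT.nonexpansive u v).continuous

/-- At a fixed point, firmness says `⟪u - z, T u - u⟫ ≤ -‖T u - u‖ ^ 2`; expanding the square
produces the loss `r * (2 - r)`. -/
theorem IsFirm.norm_relaxation_sub_sq_le {T : K → K} (hT : IsFirm T) {r : ℝ} (hr : 0 ≤ r) {z : K}
    (hz : T z = z) (u : K) :
    ‖u + r • (T u - u) - z‖ ^ 2 ≤ ‖u - z‖ ^ 2 - r * (2 - r) * ‖T u - u‖ ^ 2 := by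
  have h := hT u z
  rw [hz] at h
  have e1 : u + r • (T u - u) - z = (u - z) + r • (T u - u) := by abel
  have e2 : T u - z = (u - z) + (T u - u) := by abel
  rw [e2, norm_add_sq_real, inner_add_left, real_inner_self_eq_norm_sq,
    real_inner_comm (u - z) (T u - u)] at h
  rw [e1, norm_add_sq_real, real_inner_smul_right, norm_smul, mul_pow, Real.norm_eq_abs, sq_abs]
  nlinarith

/-- Demiclosedness principle for nonexpansive maps, along a filter. -/
theorem eq_of_weak_limit_of_nonexpansive {T : K → K} (hT : ∀ u v, ‖T u - T v‖ ≤ ‖u - v‖)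
    {ι : Type*} {F : Filter ι} [F.NeBot] {u : ι → K} {C : ℝ} (hu : ∀ᶠ i in F, ‖u i‖ ≤ C) {l : K}
    (hl : ∀ y, Tendsto (fun i => ⟪u i, y⟫_ℝ) F (𝓝 ⟪l, y⟫_ℝ))
    (hTu : Tendsto (fun i => ‖T (u i) - u i‖) F (𝓝 0)) : T l = l := by
  -- Two evaluations of `‖u i - T l‖ ^ 2` are compared: the triangle inequality with
  -- nonexpansiveness, and expansion around `l`. Their difference bounds `‖l - T l‖ ^ 2` by a null
  -- sequence.
  have h1 : Tendsto (fun i => ‖T (u i) - u i‖ ^ 2 + 2 * (C + ‖l‖) * ‖T (u i) - u i‖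
      - 2 * (⟪u i, l - T l⟫_ℝ - ⟪l, l - T l⟫_ℝ)) F
      (𝓝 (0 ^ 2 + 2 * (C + ‖l‖) * 0 - 2 * (⟪l, l - T l⟫_ℝ - ⟪l, l - T l⟫_ℝ))) :=
    ((hTu.pow 2).add (hTu.const_mul _)).sub (((hl _).sub_const _).const_mul 2)
  have h2 : ‖l - T l‖ ^ 2 ≤ 0 := by
    have h3 := ge_of_tendsto h1 (b := ‖l - T l‖ ^ 2) <| hu.mono fun i hi => by
      have a1 : ‖u i - T l‖ ≤ ‖T (u i) - u i‖ + ‖u i - l‖ := by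
        have : u i - T l = -(T (u i) - u i) + (T (u i) - T l) := by abel
        rw [this]
        exact (norm_add_le _ _).trans (by rw [norm_neg]; gcongr; exact hT _ _)
      have a2 : ‖u i - l‖ ≤ C + ‖l‖ := (norm_sub_le _ _).trans (by gcongr)
      have a3 : ‖u i - T l‖ ^ 2 ≤ (‖T (u i) - u i‖ + ‖u i - l‖) ^ 2 := by gcongr
      have a4 : u i - T l = (u i - l) + (l - T l) := by abel
      rw [a4, norm_add_sq_real, inner_sub_left] at a3
      nlinarith [norm_nonneg (T (u i) - u i)]
    simpa using h3
  have h4 : ‖l - T l‖ = 0 := by nlinarith [norm_nonneg (l - T l)]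
  exact (sub_eq_zero.1 (norm_eq_zero.1 h4)).symm

/-- Opial's lemma in the metric `⟪·, W ·⟫`: a sequence whose distances to the points of a dense
subset of the fixed point set of a nonexpansive map `T` converge, and along which `T - Id` tends to
zero, converges weakly to a fixed point. -/
theorem exists_weak_limit_of_fejer [CompleteSpace K] {T : K → K}
    (hT : ∀ u v, ‖T u - T v‖ ≤ ‖u - v‖) (W : K →L[ℝ] K)
    (hsymm : ∀ u v, ⟪W u, v⟫_ℝ = ⟪u, W v⟫_ℝ) (hpos : ∀ u, ‖u‖ ^ 2 ≤ ⟪u, W u⟫_ℝ)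
    {D : Set K} (hD : D.Nonempty) (hDT : {z | T z = z} ⊆ closure D) {u : ℕ → K}
    (hconv : ∀ z ∈ D, ∃ r, Tendsto (fun n => ⟪u n - z, W (u n - z)⟫_ℝ) atTop (𝓝 r))
    (hTu : Tendsto (fun n => ‖T (u n) - u n‖) atTop (𝓝 0)) :
    ∃ l, T l = l ∧ ∀ y, Tendsto (fun n => ⟪u n, y⟫_ℝ) atTop (𝓝 ⟪l, y⟫_ℝ) := by
  obtain ⟨C, hC⟩ : ∃ C, ∀ n, ‖u n‖ ≤ C := by
    obtain ⟨z, hz⟩ := hD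
    obtain ⟨r, hr⟩ := hconv z hz
    obtain ⟨M, hM⟩ := hr.bddAbove_range
    refine ⟨(M + 1) + ‖z‖, fun n => ?_⟩
    have h1 := (hpos (u n - z)).trans (hM ⟨n, rfl⟩)
    have h2 : ‖u n - z‖ ≤ M + 1 := by nlinarith [norm_nonneg (u n - z)]
    calc ‖u n‖ = ‖(u n - z) + z‖ := by rw [sub_add_cancel]
      _ ≤ _ := (norm_add_le _ _).trans (by gcongr)
  have hlim : ∀ U : Ultrafilter ℕ, (U : Filter ℕ) ≤ atTop → ∃ l, T l = l ∧
      ∀ y, Tendsto (fun n => ⟪u n, y⟫_ℝ) U (𝓝 ⟪l, y⟫_ℝ) := by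
    intro U hU
    obtain ⟨l, hl⟩ := exists_weak_limit U u C (Eventually.of_forall hC)
    exact ⟨l, eq_of_weak_limit_of_nonexpansive hT (Eventually.of_forall hC) hl (hTu.mono_left hU),
      hl⟩
  have huniq : ∀ U U' : Ultrafilter ℕ, (U : Filter ℕ) ≤ atTop → (U' : Filter ℕ) ≤ atTop →
      ∀ l l', T l = l → T l' = l' → (∀ y, Tendsto (fun n => ⟪u n, y⟫_ℝ) U (𝓝 ⟪l, y⟫_ℝ)) →
      (∀ y, Tendsto (fun n => ⟪u n, y⟫_ℝ) U' (𝓝 ⟪l', y⟫_ℝ)) → l = l' := by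
    intro U U' hU hU' l l' hTl hTl' hl hl'
    -- Subtracting the convergent distances to `z` and `z'` cancels the quadratic term, so `⟪u n, W
    -- (z - z')⟫` has a limit along the whole sequence. Hence `l - l'` is `W`-orthogonal to `D - D`,
    -- and by density to itself.
    have hDD : ∀ p ∈ D ×ˢ D, ⟪l - l', W (p.1 - p.2)⟫_ℝ = 0 := by
      rintro ⟨z, z'⟩ ⟨hz, hz'⟩
      obtain ⟨r, hr⟩ := hconv z hz
      obtain ⟨r', hr'⟩ := hconv z' hz'
      have hd : Tendsto (fun n => ⟪u n, W (z - z')⟫_ℝ) atTop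
          (𝓝 ((r' - r + ⟪z, W z⟫_ℝ - ⟪z', W z'⟫_ℝ) / 2)) := by
        refine (((((hr'.sub hr).add_const ⟪z, W z⟫_ℝ).sub_const ⟪z', W z'⟫_ℝ).div_const 2)).congr
          fun n => ?_
        have e : ∀ t, ⟪t, W (u n)⟫_ℝ = ⟪u n, W t⟫_ℝ := fun t => by
          rw [← hsymm, real_inner_comm]
        simp only [map_sub, inner_sub_left, inner_sub_right, e]
        ring
      have h1 := tendsto_nhds_unique (hl (W (z - z'))) (hd.mono_left hU)
      have h2 := tendsto_nhds_unique (hl' (W (z - z'))) (hd.mono_left hU')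
      simp only [inner_sub_left, h1, h2, sub_self]
    have hcl : IsClosed {p : K × K | ⟪l - l', W (p.1 - p.2)⟫_ℝ = 0} :=
      isClosed_eq (by fun_prop) continuous_const
    have hmem : (l, l') ∈ closure (D ×ˢ D) := by
      rw [closure_prod_eq]; exact ⟨hDT hTl, hDT hTl'⟩
    have h0 : ⟪l - l', W (l - l')⟫_ℝ = 0 := closure_minimal hDD hcl hmem
    have h1 := hpos (l - l')
    have h2 : ‖l - l'‖ = 0 := by nlinarith [norm_nonneg (l - l')]
    exact sub_eq_zero.1 (norm_eq_zero.1 h2)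
  obtain ⟨l, hTl, hl⟩ := hlim (Ultrafilter.of atTop) (Ultrafilter.of_le atTop)
  refine ⟨l, hTl, fun y => ?_⟩
  rw [tendsto_iff_ultrafilter]
  intro U hU
  obtain ⟨l', hTl', hl'⟩ := hlim U hU
  rw [huniq _ _ (Ultrafilter.of_le atTop) hU l l' hTl hTl' hl hl']
  exact hl' y

/-- The Douglas–Rachford operator `X ↦ J (2 Q X - X) - Q X + X`, where `Q` is the orthogonal
projection onto `V`. -/
noncomputable def drOp (V : Submodule ℝ K) [V.HasOrthogonalProjection] (J : K → K) (X : K) : K :=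
  J ((2 : ℝ) • V.starProjection X - X) - V.starProjection X + X

/-- For an orthogonal projection `⟪q, q⟫ = ⟪q, X - Y⟫`; with this identity the claim becomes exactly
the firmness of `J` at the reflected points `2 Q X - X` and `2 Q Y - Y`. -/
theorem isFirm_drOp (V : Submodule ℝ K) [V.HasOrthogonalProjection] {J : K → K} (hJ : IsFirm J) :
    IsFirm (drOp V J) := by
  intro X Y
  have h := hJ ((2 : ℝ) • V.starProjection X - X) ((2 : ℝ) • V.starProjection Y - Y)
  set j := J ((2 : ℝ) • V.starProjection X - X) - J ((2 : ℝ) • V.starProjection Y - Y) with hj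
  set q := V.starProjection (X - Y) with hq
  have e1 : drOp V J X - drOp V J Y = j - q + (X - Y) := by
    simp only [drOp, hj, hq, map_sub]; abel
  have e2 : (2 : ℝ) • V.starProjection X - X - ((2 : ℝ) • V.starProjection Y - Y)
      = (2 : ℝ) • q - (X - Y) := by
    simp only [hq, map_sub, smul_sub]; abel
  have e3 : ⟪q, q⟫_ℝ = ⟪q, X - Y⟫_ℝ := by
    rw [hq, V.inner_starProjection_left_eq_right, V.starProjection_eq_self_iff.2
      (V.starProjection_apply_mem _), ← V.inner_starProjection_left_eq_right]
  rw [e1]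
  rw [e2] at h
  set x := X - Y
  rw [← real_inner_self_eq_norm_sq] at h ⊢
  simp only [inner_sub_left, inner_sub_right, inner_add_left, inner_add_right,
    real_inner_smul_right, real_inner_comm j q, real_inner_comm j x, real_inner_comm q x] at h e3 ⊢
  linarith

end FirmlyNonexpansive

/-! ### Block structure, and fixed points versus primal-dual pairs. -/

section BlockAlgebra

variable {m p : ℕ} {H : Fin m → Type*} {G : Fin p → Type*}
  [∀ i, NormedAddCommGroup (H i)] [∀ i, InnerProductSpace ℝ (H i)]
  [∀ k, NormedAddCommGroup (G k)] [∀ k, InnerProductSpace ℝ (G k)]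

/-- The block-diagonal operator with scalar weights `s i` on `H i` and `t k` on `G k`. -/
noncomputable def blockScale (s : Fin m → ℝ) (t : Fin p → ℝ) :
    WithLp 2 (PiLp 2 H × PiLp 2 G) →L[ℝ] WithLp 2 (PiLp 2 H × PiLp 2 G) where
  toFun X := WithLp.toLp 2 (WithLp.toLp 2 fun i => s i • X.fst i,
    WithLp.toLp 2 fun k => t k • X.snd k)
  map_add' X Y := by
    apply (WithLp.equiv 2 _).injective
    ext <;> simp [smul_add]
  map_smul' c X := by
    apply (WithLp.equiv 2 _).injective
    ext <;> simp [smul_comm c]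
  cont := by fun_prop

/-- The sum of `⟪u, v⟫` over all blocks. -/
theorem inner_eq_sum_blocks (X Y : WithLp 2 (PiLp 2 H × PiLp 2 G)) :
    ⟪X, Y⟫_ℝ = ∑ i, ⟪X.fst i, Y.fst i⟫_ℝ + ∑ k, ⟪X.snd k, Y.snd k⟫_ℝ := by
  rw [WithLp.prod_inner_apply, PiLp.inner_apply, PiLp.inner_apply]
  rfl

theorem norm_sq_eq_sum_blocks (X : WithLp 2 (PiLp 2 H × PiLp 2 G)) :
    ‖X‖ ^ 2 = ∑ i, ‖X.fst i‖ ^ 2 + ∑ k, ‖X.snd k‖ ^ 2 := by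
  rw [← real_inner_self_eq_norm_sq, inner_eq_sum_blocks]
  simp only [real_inner_self_eq_norm_sq]

theorem inner_blockScale_right (s : Fin m → ℝ) (t : Fin p → ℝ)
    (X Y : WithLp 2 (PiLp 2 H × PiLp 2 G)) :
    ⟪X, blockScale s t Y⟫_ℝ
      = ∑ i, s i * ⟪X.fst i, Y.fst i⟫_ℝ + ∑ k, t k * ⟪X.snd k, Y.snd k⟫_ℝ := by
  rw [inner_eq_sum_blocks]
  simp [blockScale, real_inner_smul_right]

theorem blockScale_symm (s : Fin m → ℝ) (t : Fin p → ℝ)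
    (X Y : WithLp 2 (PiLp 2 H × PiLp 2 G)) :
    ⟪blockScale s t X, Y⟫_ℝ = ⟪X, blockScale s t Y⟫_ℝ := by
  rw [real_inner_comm, inner_blockScale_right, inner_blockScale_right]
  simp only [real_inner_comm]

theorem mem_graphSubspace_iff {L : ∀ k i, H i →L[ℝ] G k} {q : WithLp 2 (PiLp 2 H × PiLp 2 G)} :
    q ∈ graphSubspace L ↔ q.snd = blockOp L q.fst :=
  ⟨fun h => PiLp.ext h, fun h k => by rw [h]; rfl⟩

variable [∀ i, CompleteSpace (H i)] [∀ k, CompleteSpace (G k)]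

theorem inner_blockOp_left (L : ∀ k i, H i →L[ℝ] G k) (x : PiLp 2 H) (v : PiLp 2 G) :
    ⟪blockOp L x, v⟫_ℝ = ⟪x, blockAdjoint L v⟫_ℝ := by
  simp only [blockAdjoint, blockOp, PiLp.inner_apply, sum_inner, inner_sum,
    ContinuousLinearMap.adjoint_inner_right]
  exact Finset.sum_comm

theorem blockAdjoint_smul (L : ∀ k i, H i →L[ℝ] G k) (r : ℝ) (v : PiLp 2 G) :
    blockAdjoint L (r • v) = r • blockAdjoint L v := by
  ext i
  simp [blockAdjoint, blockOp, Finset.smul_sum]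

/-- The orthogonal complement of the graph of `L` is `{(-L* v, v)}`. -/
theorem mem_graphSubspace_orthogonal_iff {L : ∀ k i, H i →L[ℝ] G k}
    {q : WithLp 2 (PiLp 2 H × PiLp 2 G)} :
    q ∈ (graphSubspace L)ᗮ ↔ q.fst = -blockAdjoint L q.snd := by
  rw [Submodule.mem_orthogonal]
  constructor
  · intro h
    rw [eq_neg_iff_add_eq_zero]
    refine ext_inner_left ℝ fun x => ?_
    have := h (WithLp.toLp 2 (x, blockOp L x)) (mem_graphSubspace_iff.2 rfl)
    rw [WithLp.prod_inner_apply] at this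
    rw [inner_add_right, ← inner_blockOp_left, inner_zero_right]
    exact this
  · intro h u hu
    rw [WithLp.prod_inner_apply]
    change ⟪u.fst, q.fst⟫_ℝ + ⟪u.snd, q.snd⟫_ℝ = 0
    rw [mem_graphSubspace_iff.1 hu, h, inner_blockOp_left, inner_neg_right, neg_add_cancel]

/-- The resolvent of the product operator `γ (A × B)`, block by block. -/
noncomputable def blockResolvent (A : ∀ i, H i → Set (H i)) (B : ∀ k, G k → Set (G k)) (γ : ℝ)
    (X : WithLp 2 (PiLp 2 H × PiLp 2 G)) : WithLp 2 (PiLp 2 H × PiLp 2 G) :=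
  WithLp.toLp 2 (WithLp.toLp 2 fun i => resolvent (fun t => γ • A i t) (X.fst i),
    WithLp.toLp 2 fun k => resolvent (fun t => γ • B k t) (X.snd k))

variable {A : ∀ i, H i → Set (H i)} {B : ∀ k, G k → Set (G k)}

theorem isFirm_blockResolvent (hA : ∀ i, IsMaximallyMonotone (A i))
    (hB : ∀ k, IsMaximallyMonotone (B k)) {γ : ℝ} (hγ : 0 < γ) :
    IsFirm (blockResolvent A B γ) := by
  intro X Y
  rw [norm_sq_eq_sum_blocks, inner_eq_sum_blocks]
  exact add_le_add (Finset.sum_le_sum fun i _ => ((hA i).smul hγ).resolvent_firm _ _)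
    (Finset.sum_le_sum fun k _ => ((hB k).smul hγ).resolvent_firm _ _)

/-- A Kuhn–Tucker pair splits both inclusions at once, so one fixed point serves the primal and the
dual problem. -/
theorem mem_primalSolutions_of_dual_pair {L : ∀ k i, H i →L[ℝ] G k} {x : PiLp 2 H} {v : PiLp 2 G}
    (hx : ∀ i, -(blockAdjoint L v) i ∈ A i (x i)) (hv : ∀ k, v k ∈ B k (blockOp L x k)) :
    x ∈ primalSolutions A B L :=
  Set.mem_add.2 ⟨-blockAdjoint L v, hx, blockAdjoint L v, ⟨v, hv, rfl⟩, neg_add_cancel _⟩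

theorem mem_dualSolutions_of_primal_pair {L : ∀ k i, H i →L[ℝ] G k} {x : PiLp 2 H}
    {v : PiLp 2 G} (hx : ∀ i, -(blockAdjoint L v) i ∈ A i (x i))
    (hv : ∀ k, v k ∈ B k (blockOp L x k)) : v ∈ dualSolutions A B L :=
  Set.mem_add.2 ⟨-blockOp L x, Set.neg_mem_neg.2 ⟨x, hx, rfl⟩, blockOp L x, hv, neg_add_cancel _⟩

theorem exists_dual_pair_of_mem_primalSolutions {L : ∀ k i, H i →L[ℝ] G k} {x : PiLp 2 H}
    (h : x ∈ primalSolutions A B L) : ∃ v : PiLp 2 G,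
    (∀ i, -(blockAdjoint L v) i ∈ A i (x i)) ∧ ∀ k, v k ∈ B k (blockOp L x k) := by
  obtain ⟨u, hu, _, ⟨v, hv, rfl⟩, h0⟩ := Set.mem_add.1 h
  refine ⟨v, fun i => ?_, hv⟩
  have : u = -blockAdjoint L v := eq_neg_of_add_eq_zero_left h0
  rw [← PiLp.neg_apply, ← this]
  exact hu i

/-- A fixed point of the Douglas–Rachford operator yields a primal-dual pair. -/
theorem dual_pair_of_drOp_eq (hA : ∀ i, IsMaximallyMonotone (A i))
    (hB : ∀ k, IsMaximallyMonotone (B k)) {L : ∀ k i, H i →L[ℝ] G k} {γ : ℝ} (hγ : 0 < γ)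
    {X : WithLp 2 (PiLp 2 H × PiLp 2 G)}
    (hX : drOp (graphSubspace L) (blockResolvent A B γ) X = X) :
    (∀ i, -(blockAdjoint L (γ⁻¹ • (((graphSubspace L).starProjection X).snd - X.snd))) i
      ∈ A i (((graphSubspace L).starProjection X).fst i)) ∧
    ∀ k, (γ⁻¹ • (((graphSubspace L).starProjection X).snd - X.snd)) k
      ∈ B k (blockOp L ((graphSubspace L).starProjection X).fst k) := by
  set q := (graphSubspace L).starProjection X with hq
  -- The resolvent equation puts `q - X` in `γ (A × B) q`, while `q - X ∈ Vᗮ` forces the form `(-L*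
  -- v, v)`; division by `γ` then gives the pair.
  have hJ : blockResolvent A B γ ((2 : ℝ) • q - X) = q := by
    have : blockResolvent A B γ ((2 : ℝ) • q - X) - q + X = X := hX
    rw [add_eq_right, sub_eq_zero] at this
    exact this
  have horth : q - X ∈ (graphSubspace L)ᗮ := by
    have := (graphSubspace L).sub_starProjection_mem_orthogonal X
    rw [← neg_sub]
    exact Submodule.neg_mem _ this
  have hadj : -blockAdjoint L (q.snd - X.snd) = q.fst - X.fst :=
    (mem_graphSubspace_orthogonal_iff.1 horth).symm
  have hmem : q.snd = blockOp L q.fst :=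
    mem_graphSubspace_iff.1 ((graphSubspace L).starProjection_apply_mem X)
  constructor
  · intro i
    have h1 := ((hA i).smul hγ).sub_resolvent_mem (((2 : ℝ) • q - X).fst i)
    have h2 : resolvent (fun t => γ • A i t) (((2 : ℝ) • q - X).fst i) = q.fst i :=
      congrArg (fun Z : WithLp 2 (PiLp 2 H × PiLp 2 G) => Z.fst i) hJ
    rw [h2, mem_smul_set_iff_inv_smul_mem₀ hγ.ne'] at h1
    rw [blockAdjoint_smul, ← PiLp.neg_apply, ← smul_neg, hadj]
    convert h1 using 1
    change γ⁻¹ • (q.fst i - X.fst i) = γ⁻¹ • ((2 : ℝ) • q.fst i - X.fst i - q.fst i)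
    rw [two_smul]
    congr 1
    abel
  · intro k
    have h1 := ((hB k).smul hγ).sub_resolvent_mem (((2 : ℝ) • q - X).snd k)
    have h2 : resolvent (fun t => γ • B k t) (((2 : ℝ) • q - X).snd k) = q.snd k :=
      congrArg (fun Z : WithLp 2 (PiLp 2 H × PiLp 2 G) => Z.snd k) hJ
    rw [h2, mem_smul_set_iff_inv_smul_mem₀ hγ.ne'] at h1
    rw [← hmem]
    convert h1 using 1
    change γ⁻¹ • (q.snd k - X.snd k) = γ⁻¹ • ((2 : ℝ) • q.snd k - X.snd k - q.snd k)
    rw [two_smul]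
    congr 1
    abel

/-- The Douglas–Rachford operator has a fixed point when the primal problem has a solution. -/
theorem exists_drOp_eq (hA : ∀ i, IsMaximallyMonotone (A i))
    (hB : ∀ k, IsMaximallyMonotone (B k)) {L : ∀ k i, H i →L[ℝ] G k} {γ : ℝ} (hγ : 0 < γ)
    (hF : (primalSolutions A B L).Nonempty) :
    ∃ X, drOp (graphSubspace L) (blockResolvent A B γ) X = X := by
  obtain ⟨x, hx⟩ := hF
  obtain ⟨v, hAv, hBv⟩ := exists_dual_pair_of_mem_primalSolutions hx
  -- The fixed point is `q - γ • n` with `q ∈ V` and `n ∈ Vᗮ`: its projection is `q`, its reflection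
  -- is `q + γ • n`, and the resolvent sends the latter back to `q`.
  let q : WithLp 2 (PiLp 2 H × PiLp 2 G) := WithLp.toLp 2 (x, blockOp L x)
  let n : WithLp 2 (PiLp 2 H × PiLp 2 G) := WithLp.toLp 2 (-blockAdjoint L v, v)
  have hQ : (graphSubspace L).starProjection (q - γ • n) = q := by
    refine Submodule.eq_starProjection_of_mem_orthogonal (mem_graphSubspace_iff.2 rfl) ?_
    rw [sub_sub_cancel_left]
    exact Submodule.neg_mem _ (Submodule.smul_mem _ _ (mem_graphSubspace_orthogonal_iff.2 rfl))
  refine ⟨q - γ • n, ?_⟩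
  rw [drOp, hQ, add_eq_right, sub_eq_zero]
  have e : (2 : ℝ) • q - (q - γ • n) = q + γ • n := by rw [two_smul]; abel
  rw [e]
  apply (WithLp.equiv 2 _).injective
  refine Prod.ext (PiLp.ext fun i => ?_) (PiLp.ext fun k => ?_)
  · refine ((hA i).smul hγ).resolvent_eq ?_
    change x i + γ • -(blockAdjoint L v) i - x i ∈ γ • A i (x i)
    rw [add_sub_cancel_left]
    exact smul_mem_smul_set (hAv i)
  · refine ((hB k).smul hγ).resolvent_eq ?_
    change blockOp L x k + γ • v k - blockOp L x k ∈ γ • B k (blockOp L x k)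
    rw [add_sub_cancel_left]
    exact smul_mem_smul_set (hBv k)

end BlockAlgebra

/-! ### Almost supermartingales without integrability of the initial value. -/

section RobbinsSiegmund

variable {Ω : Type*} {mΩ : MeasurableSpace Ω} {P : Measure Ω}

/-- The conditional expectation can be pulled out of an integral against a measurable weight. -/
theorem lintegral_mul_condLExp {Ω : Type*} {m mΩ : MeasurableSpace Ω} {P : Measure Ω}
    [IsFiniteMeasure P] (hm : m ≤ mΩ)
    {X : Ω → ℝ≥0∞} (hX : Measurable X) {f : Ω → ℝ≥0∞} (hf : Measurable[m] f) :
    ∫⁻ ω, f ω * condLExp m P X ω ∂P = ∫⁻ ω, f ω * X ω ∂P := by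
  have hC : Measurable (condLExp m P X) := measurable_condLExp' _ _ _
  refine Measurable.ennreal_induction
    (motive := fun f => ∫⁻ ω, f ω * condLExp m P X ω ∂P = ∫⁻ ω, f ω * X ω ∂P) ?_ ?_ ?_ hf
  · intro c s hs
    have e : ∀ Z : Ω → ℝ≥0∞, ∀ ω, s.indicator (fun _ => c) ω * Z ω
        = s.indicator (fun ω => c * Z ω) ω := fun Z ω => by
      by_cases h : ω ∈ s <;> simp [h]
    simp only [e]
    rw [lintegral_indicator (hm _ hs), lintegral_indicator (hm _ hs), lintegral_const_mul _ hC,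
      lintegral_const_mul _ hX, setLIntegral_condLExp hm _ _ hs]
  · intro f g _ hf _ ihf ihg
    have hf' := hf.mono hm le_rfl
    simp only [Pi.add_apply, add_mul]
    rw [lintegral_add_left (hf'.fun_mul hC), lintegral_add_left (hf'.fun_mul hX), ihf, ihg]
  · intro f hf hmono ih
    have hf' := fun n => (hf n).mono hm le_rfl
    simp only [ENNReal.iSup_mul]
    rw [lintegral_iSup (fun n => (hf' n).fun_mul hC)
        (fun i j hij ω => mul_le_mul_left (hmono hij ω) _),
      lintegral_iSup (fun n => (hf' n).fun_mul hX)
        (fun i j hij ω => mul_le_mul_left (hmono hij ω) _)]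
    simp only [ih]

/-- A nonnegative process whose integrals over past events decrease converges almost surely. -/
theorem ae_tendsto_of_lintegral_le [IsFiniteMeasure P] (ℱ : Filtration ℕ mΩ) {S : ℕ → Ω → ℝ}
    (hS : ∀ n, Measurable[ℱ n] (S n)) (h0 : ∀ n ω, 0 ≤ S n ω) {c : ℝ}
    (hc : ∀ ω, S 0 ω ≤ c)
    (hle : ∀ n s, MeasurableSet[ℱ n] s →
      ∫⁻ ω in s, ENNReal.ofReal (S (n + 1) ω) ∂P ≤ ∫⁻ ω in s, ENNReal.ofReal (S n ω) ∂P) :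
    ∀ᵐ ω ∂P, ∃ l, Tendsto (fun n => S n ω) atTop (𝓝 l) := by
  have hSm : ∀ n, Measurable (S n) := fun n => (hS n).mono (ℱ.le n) le_rfl
  have hbd : ∀ n, ∫⁻ ω, ENNReal.ofReal (S n ω) ∂P ≤ ENNReal.ofReal c * P univ := by
    intro n
    induction n with
    | zero =>
      calc _ ≤ ∫⁻ _, ENNReal.ofReal c ∂P :=
            lintegral_mono fun ω => ENNReal.ofReal_le_ofReal (hc ω)
        _ = _ := lintegral_const _
    | succ n ih => simpa using (hle n univ MeasurableSet.univ).trans (by simpa using ih)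
  have hfin : ENNReal.ofReal c * P univ ≠ ∞ :=
    ENNReal.mul_ne_top ENNReal.ofReal_ne_top (measure_ne_top _ _)
  have hint : ∀ n, Integrable (S n) P := fun n =>
    ⟨(hSm n).aestronglyMeasurable, (hasFiniteIntegral_iff_ofReal
      (Eventually.of_forall (h0 n))).2 ((hbd n).trans_lt hfin.lt_top)⟩
  have hsuper : Supermartingale S ℱ P := by
    refine supermartingale_of_setIntegral_succ_le (fun n => (hS n).stronglyMeasurable) hint
      fun n s hs => ?_
    rw [integral_eq_lintegral_of_nonneg_ae (Eventually.of_forall (h0 _))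
        (hSm _).aestronglyMeasurable,
      integral_eq_lintegral_of_nonneg_ae (Eventually.of_forall (h0 _))
        (hSm _).aestronglyMeasurable]
    refine ENNReal.toReal_mono ?_ (hle n s hs)
    exact ((setLIntegral_le_lintegral _ _).trans (hbd n)).trans_lt hfin.lt_top |>.ne
  -- The negated process is an `L¹`-bounded submartingale, to which Doob's convergence theorem
  -- applies.
  have hsub := hsuper.neg
  have hL1 : ∀ n, eLpNorm ((-S) n) 1 P ≤ ((ENNReal.ofReal c * P univ).toNNReal : ℝ≥0∞) := by
    intro n
    rw [ENNReal.coe_toNNReal hfin, eLpNorm_one_eq_lintegral_enorm]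
    refine le_trans (le_of_eq (lintegral_congr fun ω => ?_)) (hbd n)
    rw [Pi.neg_apply, Pi.neg_apply, enorm_neg, Real.enorm_of_nonneg (h0 n ω)]
  filter_upwards [hsub.exists_ae_tendsto_of_bdd hL1] with ω ⟨l, hl⟩
  exact ⟨-l, by simpa using hl.neg⟩

/-- The Robbins–Siegmund theorem without multiplicative perturbation; no integrability of `α 0` is
assumed. -/
theorem ae_tendsto_and_summable_of_lintegral_le_add [IsFiniteMeasure P] (ℱ : Filtration ℕ mΩ)
    {α θ η : ℕ → Ω → ℝ} (hα : ∀ n, Measurable[ℱ n] (α n)) (hθ : ∀ n, Measurable[ℱ n] (θ n))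
    (hη : ∀ n, Measurable[ℱ n] (η n)) (hα0 : ∀ n ω, 0 ≤ α n ω) (hθ0 : ∀ n ω, 0 ≤ θ n ω)
    (hη0 : ∀ n ω, 0 ≤ η n ω)
    (hle : ∀ n (f : Ω → ℝ≥0∞), Measurable[ℱ n] f →
      ∫⁻ ω, f ω * ENNReal.ofReal (α (n + 1) ω + θ n ω) ∂P
        ≤ ∫⁻ ω, f ω * ENNReal.ofReal (α n ω + η n ω) ∂P)
    (hsum : ∀ᵐ ω ∂P, Summable fun n => η n ω) :
    ∀ᵐ ω ∂P, (∃ l, Tendsto (fun n => α n ω) atTop (𝓝 l)) ∧ Summable fun n => θ n ω := by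
  -- Localization: on `B c n` the initial value and the accumulated `η` are at most `c`, so the
  -- compensated process `Wc` is nonnegative there and starts below `2 * c`.
  let B : ℕ → ℕ → Set Ω := fun c n => {ω | α 0 ω ≤ c ∧ ∑ k ∈ Finset.range n, η k ω ≤ c}
  let Wc : ℕ → ℕ → Ω → ℝ := fun c n ω => α n ω + ∑ k ∈ Finset.range n, θ k ω
    + (c - ∑ k ∈ Finset.range n, η k ω)
  have hsumm : ∀ {g : ℕ → Ω → ℝ}, (∀ n, Measurable[ℱ n] (g n)) → ∀ n N, n ≤ N + 1 →
      Measurable[ℱ N] fun ω => ∑ k ∈ Finset.range n, g k ω := by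
    intro g hg n N hn
    refine Finset.measurable_sum _ fun k hk => (hg k).mono (ℱ.mono ?_) le_rfl
    have := Finset.mem_range.1 hk
    omega
  -- The sum in `B c (n + 1)` stops at `η n`, so this event is already `ℱ n`-measurable and can
  -- serve as a weight for the step from `n` to `n + 1`.
  have hBm : ∀ c n N, n ≤ N + 1 → MeasurableSet[ℱ N] (B c n) := fun c n N hn =>
    MeasurableSet.inter
      (measurableSet_le ((hα 0).mono (ℱ.mono (Nat.zero_le _)) le_rfl) measurable_const)
      (measurableSet_le (hsumm hη n N hn) measurable_const)
  have hBanti : ∀ c n, B c (n + 1) ⊆ B c n := fun c n ω hω => ⟨hω.1, by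
    have := hω.2
    rw [Finset.sum_range_succ] at this
    have := hη0 n ω
    linarith⟩
  have hconv : ∀ c : ℕ, ∀ᵐ ω ∂P, ∃ l,
      Tendsto (fun n => (B c n).indicator (Wc c n) ω) atTop (𝓝 l) := by
    intro c
    have hWm : ∀ n, Measurable[ℱ n] (Wc c n) := fun n =>
      ((hα n).add (hsumm hθ n n n.le_succ)).add (measurable_const.sub (hsumm hη n n n.le_succ))
    refine ae_tendsto_of_lintegral_le ℱ (c := 2 * c)
      (fun n => (hWm n).indicator (hBm c n n n.le_succ)) (fun n ω => ?_) (fun ω => ?_) ?_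
    · refine indicator_nonneg (fun ω hω => ?_) ω
      have h1 := hα0 n ω
      have h2 : 0 ≤ ∑ k ∈ Finset.range n, θ k ω := Finset.sum_nonneg fun k _ => hθ0 k ω
      have h3 := hω.2
      simp only [Wc]
      linarith
    · by_cases hω : ω ∈ B c 0
      · rw [indicator_of_mem hω]
        have := hω.1
        simp only [Wc, Finset.range_zero, Finset.sum_empty]
        linarith
      · rw [indicator_of_notMem hω]; positivity
    · intro n s hs
      have hs' := ℱ.le n _ hs
      have hsB : MeasurableSet[ℱ n] (s ∩ B c (n + 1)) :=
        MeasurableSet.inter hs (hBm c (n + 1) n le_rfl)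
      let g : Ω → ℝ≥0∞ := (s ∩ B c (n + 1)).indicator 1
      have hg : Measurable[ℱ n] g := Measurable.indicator measurable_const hsB
      let r : Ω → ℝ := fun ω => ∑ k ∈ Finset.range n, θ k ω
        + (c - ∑ k ∈ Finset.range (n + 1), η k ω)
      have hr : Measurable[ℱ n] r :=
        (hsumm hθ n n n.le_succ).add (measurable_const.sub (hsumm hη (n + 1) n le_rfl))
      have hgr : Measurable fun ω => g ω * ENNReal.ofReal (r ω) :=
        (hg.mono (ℱ.le n) le_rfl).mul (hr.mono (ℱ.le n) le_rfl).ennreal_ofReal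
      have hr0 : ∀ ω ∈ B c (n + 1), 0 ≤ r ω := fun ω hω => by
        have h2 : 0 ≤ ∑ k ∈ Finset.range n, θ k ω := Finset.sum_nonneg fun k _ => hθ0 k ω
        have h3 := hω.2
        simp only [r]
        linarith
      rw [← lintegral_indicator hs', ← lintegral_indicator hs']
      calc ∫⁻ ω, s.indicator (fun ω => ENNReal.ofReal ((B c (n + 1)).indicator (Wc c (n + 1)) ω)) ω
            ∂P
          = ∫⁻ ω, (g ω * ENNReal.ofReal (α (n + 1) ω + θ n ω) + g ω * ENNReal.ofReal (r ω)) ∂P := by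
            refine lintegral_congr fun ω => ?_
            by_cases h1 : ω ∈ s <;> by_cases h2 : ω ∈ B c (n + 1)
            · simp only [g, h1, h2, indicator_of_mem, mem_inter_iff, and_self, Pi.one_apply, one_mul]
              rw [← ENNReal.ofReal_add (add_nonneg (hα0 _ _) (hθ0 _ _)) (hr0 ω h2)]
              congr 1
              simp only [Wc, r, Finset.sum_range_succ]
              ring
            all_goals simp [g, h1, h2]
        _ ≤ ∫⁻ ω, (g ω * ENNReal.ofReal (α n ω + η n ω) + g ω * ENNReal.ofReal (r ω)) ∂P := by
            rw [lintegral_add_right _ hgr, lintegral_add_right _ hgr]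
            exact add_le_add (hle n g hg) le_rfl
        _ ≤ _ := by
            refine lintegral_mono fun ω => ?_
            by_cases h1 : ω ∈ s <;> by_cases h2 : ω ∈ B c (n + 1)
            · simp only [g, h1, h2, hBanti c n h2, indicator_of_mem, mem_inter_iff, and_self,
                Pi.one_apply, one_mul]
              rw [← ENNReal.ofReal_add (add_nonneg (hα0 _ _) (hη0 _ _)) (hr0 ω h2)]
              apply ENNReal.ofReal_le_ofReal
              simp only [Wc, r, Finset.sum_range_succ]
              linarith
            all_goals simp [g, h1, h2]
  filter_upwards [ae_all_iff.2 hconv, hsum] with ω hω hηω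
  -- For almost every `ω` some level `c` is never exceeded, so the localized process is eventually
  -- the true one: the cut is inactive at every `n`.
  obtain ⟨c, hc⟩ := exists_nat_ge (max (α 0 ω) (∑' n, η n ω))
  have hmem : ∀ n, ω ∈ B c n := fun n => ⟨(le_max_left _ _).trans hc,
    (hηω.sum_le_tsum _ fun k _ => hη0 k ω).trans ((le_max_right _ _).trans hc)⟩
  obtain ⟨l, hl⟩ := hω c
  have hW : Tendsto (fun n => Wc c n ω) atTop (𝓝 l) := by
    refine hl.congr fun n => ?_
    rw [indicator_of_mem (hmem n)]
  have hA : Tendsto (fun n => α n ω + ∑ k ∈ Finset.range n, θ k ω) atTop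
      (𝓝 (l - (c - ∑' n, η n ω))) := by
    refine (hW.sub (hηω.hasSum.tendsto_sum_nat.const_sub (c : ℝ))).congr fun n => ?_
    simp only [Wc]
    ring
  have hθs : Summable fun n => θ n ω := by
    obtain ⟨M, hM⟩ := hA.bddAbove_range
    refine summable_of_sum_range_le (c := M) (fun n => hθ0 n ω) fun n => ?_
    have := hM ⟨n, rfl⟩
    have := hα0 n ω
    simp only at *
    linarith
  exact ⟨⟨_, (hA.sub hθs.hasSum.tendsto_sum_nat).congr fun n => by ring⟩, hθs⟩

/-- The Robbins–Siegmund theorem: if `E[α (n+1) | ℱ n] ≤ (1 + χ n) α n - θ n + η n` with summable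
perturbations, then `α n` converges and `θ` is summable almost surely. The conditional inequality
is expressed by integrals against `ℱ n`-measurable weights; `α 0` need not be integrable. -/
theorem robbins_siegmund [IsFiniteMeasure P] (ℱ : Filtration ℕ mΩ)
    {α θ χ η : ℕ → Ω → ℝ} (hα : ∀ n, Measurable[ℱ n] (α n)) (hθ : ∀ n, Measurable[ℱ n] (θ n))
    (hχ : ∀ n, Measurable[ℱ n] (χ n)) (hη : ∀ n, Measurable[ℱ n] (η n))
    (hα0 : ∀ n ω, 0 ≤ α n ω) (hθ0 : ∀ n ω, 0 ≤ θ n ω)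
    (hχ0 : ∀ n ω, 0 ≤ χ n ω) (hη0 : ∀ n ω, 0 ≤ η n ω)
    (hle : ∀ n (f : Ω → ℝ≥0∞), Measurable[ℱ n] f →
      ∫⁻ ω, f ω * ENNReal.ofReal (α (n + 1) ω + θ n ω) ∂P
        ≤ ∫⁻ ω, f ω * ENNReal.ofReal ((1 + χ n ω) * α n ω + η n ω) ∂P)
    (hsumχ : ∀ᵐ ω ∂P, Summable fun n => χ n ω) (hsum : ∀ᵐ ω ∂P, Summable fun n => η n ω) :
    ∀ᵐ ω ∂P, (∃ l, Tendsto (fun n => α n ω) atTop (𝓝 l)) ∧ Summable fun n => θ n ω := by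
  -- Dividing by `ρ` absorbs the factors `1 + χ n`; `ρ (n + 1)` is `ℱ n`-measurable, and `ρ`
  -- converges because it increases and is bounded by the exponential of `∑ χ`.
  let ρ : ℕ → Ω → ℝ := fun n ω => ∏ k ∈ Finset.range n, (1 + χ k ω)
  have hρ1 : ∀ n ω, 1 ≤ ρ n ω := fun n ω =>
    Finset.one_le_prod fun k _ => by linarith [hχ0 k ω]
  have hρ0 : ∀ n ω, 0 < ρ n ω := fun n ω => one_pos.trans_le (hρ1 n ω)
  have hρm : ∀ n N, n ≤ N + 1 → Measurable[ℱ N] (ρ n) := fun n N hn =>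
    Finset.measurable_prod _ fun k hk => measurable_const.add ((hχ k).mono (ℱ.mono (by
      have := Finset.mem_range.1 hk
      omega)) le_rfl)
  have hmain := ae_tendsto_and_summable_of_lintegral_le_add (P := P) ℱ
    (α := fun n ω => α n ω / ρ n ω) (θ := fun n ω => θ n ω / ρ (n + 1) ω)
    (η := fun n ω => η n ω / ρ (n + 1) ω)
    (fun n => (hα n).div (hρm n n n.le_succ)) (fun n => (hθ n).div (hρm (n + 1) n le_rfl))
    (fun n => (hη n).div (hρm (n + 1) n le_rfl))
    (fun n ω => div_nonneg (hα0 n ω) (hρ0 n ω).le)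
    (fun n ω => div_nonneg (hθ0 n ω) (hρ0 _ ω).le)
    (fun n ω => div_nonneg (hη0 n ω) (hρ0 _ ω).le)
    (fun n f hf => by
      have hw : Measurable[ℱ n] fun ω => f ω * ENNReal.ofReal (ρ (n + 1) ω)⁻¹ :=
        hf.mul (hρm (n + 1) n le_rfl).inv.ennreal_ofReal
      refine le_trans (le_of_eq (lintegral_congr fun ω => ?_))
        ((hle n _ hw).trans (le_of_eq (lintegral_congr fun ω => ?_)))
      · rw [mul_assoc, ← ENNReal.ofReal_mul (inv_nonneg.2 (hρ0 _ _).le)]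
        congr 2
        ring
      · rw [mul_assoc, ← ENNReal.ofReal_mul (inv_nonneg.2 (hρ0 _ _).le)]
        congr 2
        have h1 : ρ (n + 1) ω = ρ n ω * (1 + χ n ω) := Finset.prod_range_succ _ _
        have h2 := (hρ0 n ω).ne'
        have h3 : 1 + χ n ω ≠ 0 := by linarith [hχ0 n ω]
        rw [h1]
        field_simp)
    (hsum.mono fun ω hω => hω.of_nonneg_of_le (fun n => div_nonneg (hη0 n ω) (hρ0 _ ω).le)
      fun n => div_le_self (hη0 n ω) (hρ1 _ ω))
  filter_upwards [hmain, hsumχ] with ω ⟨⟨l, hl⟩, hθs⟩ hχs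
  obtain ⟨r, hr⟩ : ∃ r, Tendsto (fun n => ρ n ω) atTop (𝓝 r) := by
    refine ⟨_, tendsto_atTop_ciSup (monotone_nat_of_le_succ fun n => ?_)
      ⟨Real.exp (∑' k, χ k ω), ?_⟩⟩
    · have h1 : ρ (n + 1) ω = ρ n ω * (1 + χ n ω) := Finset.prod_range_succ _ _
      rw [h1]
      exact le_mul_of_one_le_right (hρ0 n ω).le (by linarith [hχ0 n ω])
    · rintro _ ⟨n, rfl⟩
      calc ρ n ω ≤ ∏ k ∈ Finset.range n, Real.exp (χ k ω) :=
            Finset.prod_le_prod (fun k _ => by linarith [hχ0 k ω])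
              fun k _ => by linarith [Real.add_one_le_exp (χ k ω)]
        _ = Real.exp (∑ k ∈ Finset.range n, χ k ω) := (Real.exp_sum _ _).symm
        _ ≤ _ := Real.exp_le_exp.2 (hχs.sum_le_tsum _ fun k _ => hχ0 k ω)
  refine ⟨⟨_, (hl.mul hr).congr fun n => div_mul_cancel₀ _ (hρ0 n ω).ne'⟩, ?_⟩
  obtain ⟨M, hM⟩ := hr.bddAbove_range
  refine (hθs.mul_left M).of_nonneg_of_le (fun n => hθ0 n ω) fun n => ?_
  calc θ n ω = ρ (n + 1) ω * (θ n ω / ρ (n + 1) ω) := (mul_div_cancel₀ _ (hρ0 _ ω).ne').symm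
    _ ≤ _ := mul_le_mul_of_nonneg_right (hM ⟨n + 1, rfl⟩) (div_nonneg (hθ0 n ω) (hρ0 _ ω).le)

end RobbinsSiegmund

/-! ### Random activation of blocks. -/

section RandomSweeping

variable {Ω : Type*} {mΩ : MeasurableSpace Ω} {P : Measure Ω}

/-- Integral of a function over an independent event. -/
theorem setLIntegral_eq_mul_of_indep {Ω : Type*} {m m' mΩ : MeasurableSpace Ω} {P : Measure Ω}
    (hm : m ≤ mΩ) (hm' : m' ≤ mΩ) (h : Indep m' m P) {s : Set Ω} (hs : MeasurableSet[m'] s)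
    {f : Ω → ℝ≥0∞} (hf : Measurable[m] f) : ∫⁻ ω in s, f ω ∂P = P s * ∫⁻ ω, f ω ∂P := by
  have hone : Measurable[m'] (s.indicator (1 : Ω → ℝ≥0∞)) :=
    Measurable.indicator measurable_const hs
  have h1 := lintegral_mul_eq_lintegral_mul_lintegral_of_independent_measurableSpace hm' hm h
    hone hf
  rw [lintegral_indicator_one (hm' _ hs)] at h1
  rw [← h1, ← lintegral_indicator (hm' _ hs)]
  refine lintegral_congr fun ω => ?_
  by_cases hω : ω ∈ s <;> simp [hω]

/-- One block of a randomly swept iteration: the weighted mean of the new value `u'` is controlled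
by the old value `u`, the value `t` produced by an activation (with probability `r`) and the
conditional second moment `s ^ 2` of the error. -/
theorem lintegral_block_le {Ω : Type*} {m mΩ : MeasurableSpace Ω} {P : Measure Ω}
    [IsFiniteMeasure P] (hm : m ≤ mΩ)
    {E : Set Ω} (hEm : MeasurableSet E) {r : ℝ} (hr0 : 0 < r) (hr1 : r ≤ 1)
    (hE : ∀ f : Ω → ℝ≥0∞, Measurable[m] f →
      ∫⁻ ω in E, f ω ∂P = ENNReal.ofReal r * ∫⁻ ω, f ω ∂P)
    (hEc : ∀ f : Ω → ℝ≥0∞, Measurable[m] f →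
      ∫⁻ ω in Eᶜ, f ω ∂P = ENNReal.ofReal (1 - r) * ∫⁻ ω, f ω ∂P)
    {u t σ e u' : Ω → ℝ} (hu : Measurable[m] u) (ht : Measurable[m] t) (hσ : Measurable[m] σ)
    (hu0 : ∀ ω, 0 ≤ u ω) (ht0 : ∀ ω, 0 ≤ t ω) (hσ0 : ∀ ω, 0 < σ ω) (he0 : ∀ ω, 0 ≤ e ω)
    (he : ∀ f : Ω → ℝ≥0∞, Measurable[m] f →
      ∫⁻ ω, f ω * ENNReal.ofReal (e ω) ∂P ≤ ∫⁻ ω, f ω * ENNReal.ofReal (σ ω ^ 2) ∂P)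
    (hon : ∀ᵐ ω ∂P, ω ∈ E → u' ω ≤ (1 + σ ω) * t ω + (1 + (σ ω)⁻¹) * e ω)
    (hoff : ∀ᵐ ω ∂P, ω ∉ E → u' ω ≤ u ω)
    {f : Ω → ℝ≥0∞} (hf : Measurable[m] f) :
    ∫⁻ ω, f ω * ENNReal.ofReal (r⁻¹ * u' ω) ∂P
      ≤ ∫⁻ ω, f ω * ENNReal.ofReal ((1 + σ ω) * t ω + (r⁻¹ - 1) * u ω
          + r⁻¹ * (σ ω ^ 2 + σ ω)) ∂P := by
  have hri : 0 < r⁻¹ := inv_pos.2 hr0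
  have hri1 : 0 ≤ r⁻¹ - 1 := sub_nonneg.2 ((one_le_inv₀ hr0).2 hr1)
  have hg1 : Measurable[m] fun ω => f ω * ENNReal.ofReal (r⁻¹ * ((1 + σ ω) * t ω)) :=
    hf.mul (measurable_const.mul ((measurable_const.add hσ).mul ht)).ennreal_ofReal
  have hg2 : Measurable[m] fun ω => f ω * ENNReal.ofReal (r⁻¹ * u ω) :=
    hf.mul (measurable_const.mul hu).ennreal_ofReal
  have hw : Measurable[m] fun ω => f ω * ENNReal.ofReal (r⁻¹ * (1 + (σ ω)⁻¹)) :=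
    hf.mul (measurable_const.mul (measurable_const.add hσ.inv)).ennreal_ofReal
  have hk1 : Measurable fun ω => f ω * ENNReal.ofReal ((1 + σ ω) * t ω) :=
    (hf.mul ((measurable_const.add hσ).mul ht).ennreal_ofReal).mono hm le_rfl
  have hk2 : Measurable fun ω => f ω * ENNReal.ofReal ((r⁻¹ - 1) * u ω) :=
    (hf.mul (measurable_const.mul hu).ennreal_ofReal).mono hm le_rfl
  -- With weight `r⁻¹`, activation contributes exactly `t` and inactivity `(r⁻¹ - 1) * u`. The error
  -- may depend on `E`, so its term is kept on the whole space; there `(1 + σ⁻¹) * σ ^ 2 = σ ^ 2 +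
  -- σ`.
  calc ∫⁻ ω, f ω * ENNReal.ofReal (r⁻¹ * u' ω) ∂P
      ≤ ∫⁻ ω, ((E.indicator (fun ω => f ω * ENNReal.ofReal (r⁻¹ * ((1 + σ ω) * t ω))) ω
          + Eᶜ.indicator (fun ω => f ω * ENNReal.ofReal (r⁻¹ * u ω)) ω)
          + f ω * ENNReal.ofReal (r⁻¹ * (1 + (σ ω)⁻¹)) * ENNReal.ofReal (e ω)) ∂P := by
        refine lintegral_mono_ae ?_
        filter_upwards [hon, hoff] with ω h1 h2
        have hσω := hσ0 ω
        have hσi := inv_pos.2 hσω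
        by_cases hω : ω ∈ E
        · rw [indicator_of_mem hω, indicator_of_notMem (by simpa using hω), add_zero, mul_assoc,
            ← mul_add, ← ENNReal.ofReal_mul (by positivity), ← ENNReal.ofReal_add
              (mul_nonneg hri.le (mul_nonneg (by positivity) (ht0 ω)))
              (mul_nonneg (by positivity) (he0 ω))]
          gcongr
          have := mul_le_mul_of_nonneg_left (h1 hω) hri.le
          linarith
        · rw [indicator_of_notMem hω, indicator_of_mem (by simpa using hω), zero_add]
          refine le_add_right ?_
          gcongr
          exact h2 hω
    _ = (∫⁻ ω in E, f ω * ENNReal.ofReal (r⁻¹ * ((1 + σ ω) * t ω)) ∂P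
          + ∫⁻ ω in Eᶜ, f ω * ENNReal.ofReal (r⁻¹ * u ω) ∂P)
          + ∫⁻ ω, f ω * ENNReal.ofReal (r⁻¹ * (1 + (σ ω)⁻¹)) * ENNReal.ofReal (e ω) ∂P := by
        rw [lintegral_add_left (((hg1.mono hm le_rfl).indicator hEm).fun_add
            ((hg2.mono hm le_rfl).indicator hEm.compl)),
          lintegral_add_left ((hg1.mono hm le_rfl).indicator hEm), lintegral_indicator hEm,
          lintegral_indicator hEm.compl]
    _ ≤ (∫⁻ ω, f ω * ENNReal.ofReal ((1 + σ ω) * t ω) ∂P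
          + ∫⁻ ω, f ω * ENNReal.ofReal ((r⁻¹ - 1) * u ω) ∂P)
          + ∫⁻ ω, f ω * ENNReal.ofReal (r⁻¹ * (1 + (σ ω)⁻¹)) * ENNReal.ofReal (σ ω ^ 2) ∂P := by
        refine add_le_add (add_le_add (le_of_eq ?_) (le_of_eq ?_)) (he _ hw)
        · rw [hE _ hg1, ← lintegral_const_mul _ (hg1.mono hm le_rfl)]
          refine lintegral_congr fun ω => ?_
          rw [mul_left_comm, ← ENNReal.ofReal_mul hr0.le, mul_inv_cancel_left₀ hr0.ne']
        · rw [hEc _ hg2, ← lintegral_const_mul _ (hg2.mono hm le_rfl)]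
          refine lintegral_congr fun ω => ?_
          rw [mul_left_comm, ← ENNReal.ofReal_mul (by linarith), ← mul_assoc]
          congr 3
          field_simp
    _ = _ := by
        rw [← lintegral_add_left hk1, ← lintegral_add_left (hk1.fun_add hk2)]
        refine lintegral_congr fun ω => ?_
        have hσω := hσ0 ω
        have hσi := inv_pos.2 hσω
        rw [mul_assoc (f ω), ← ENNReal.ofReal_mul (by positivity), ← mul_add, ← mul_add,
          ← ENNReal.ofReal_add (mul_nonneg (by positivity) (ht0 ω)) (mul_nonneg hri1 (hu0 ω)),
          ← ENNReal.ofReal_add (add_nonneg (mul_nonneg (by positivity) (ht0 ω))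
            (mul_nonneg hri1 (hu0 ω))) (by positivity)]
        congr 3
        field_simp

/-- Convergence of a randomly swept block iteration: block `j` is activated at step `n` on the
event `E j n`, which has probability `r j` and is independent of the past. -/
theorem ae_tendsto_of_random_sweeping [IsFiniteMeasure P] (ℱ : Filtration ℕ mΩ)
    {ι : Type*} [Fintype ι] {E : ι → ℕ → Set Ω} (hEm : ∀ j n, MeasurableSet (E j n))
    {r : ι → ℝ} (hr0 : ∀ j, 0 < r j) (hr1 : ∀ j, r j ≤ 1)
    (hE : ∀ j n (f : Ω → ℝ≥0∞), Measurable[ℱ n] f →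
      ∫⁻ ω in E j n, f ω ∂P = ENNReal.ofReal (r j) * ∫⁻ ω, f ω ∂P)
    (hEc : ∀ j n (f : Ω → ℝ≥0∞), Measurable[ℱ n] f →
      ∫⁻ ω in (E j n)ᶜ, f ω ∂P = ENNReal.ofReal (1 - r j) * ∫⁻ ω, f ω ∂P)
    {u t : ι → ℕ → Ω → ℝ} {θ e : ℕ → Ω → ℝ} {s : ℕ → Ω → ℝ≥0∞}
    (hu : ∀ j n, Measurable[ℱ n] (u j n)) (ht : ∀ j n, Measurable[ℱ n] (t j n))
    (hθ : ∀ n, Measurable[ℱ n] (θ n)) (hs : ∀ n, Measurable[ℱ n] (s n))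
    (hu0 : ∀ j n ω, 0 ≤ u j n ω) (ht0 : ∀ j n ω, 0 ≤ t j n ω)
    (hθ0 : ∀ n ω, 0 ≤ θ n ω) (he0 : ∀ n ω, 0 ≤ e n ω)
    (he : ∀ n (f : Ω → ℝ≥0∞), Measurable[ℱ n] f →
      ∫⁻ ω, f ω * ENNReal.ofReal (e n ω) ∂P ≤ ∫⁻ ω, f ω * s n ω ^ 2 ∂P)
    (hs_sum : ∀ᵐ ω ∂P, ∑' n, s n ω < ∞)
    (hon : ∀ j n, ∀ᵐ ω ∂P, ω ∈ E j n → ∀ σ : ℝ, 0 < σ →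
      u j (n + 1) ω ≤ (1 + σ) * t j n ω + (1 + σ⁻¹) * e n ω)
    (hoff : ∀ j n, ∀ᵐ ω ∂P, ω ∉ E j n → u j (n + 1) ω ≤ u j n ω)
    (hdec : ∀ n ω, ∑ j, t j n ω + θ n ω ≤ ∑ j, u j n ω) :
    ∀ᵐ ω ∂P, (∃ l, Tendsto (fun n => ∑ j, (r j)⁻¹ * u j n ω) atTop (𝓝 l)) ∧
      Summable fun n => θ n ω := by
  -- The Young parameter is the size of the error itself, which makes both perturbations summable;
  -- the geometric term keeps it positive so that `σ⁻¹` makes sense.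
  let σ : ℕ → Ω → ℝ := fun n ω => (s n ω).toReal + (1 / 2) ^ n
  have hσ : ∀ n, Measurable[ℱ n] (σ n) := fun n => (hs n).ennreal_toReal.add measurable_const
  have hσ0 : ∀ n ω, 0 < σ n ω := fun n ω =>
    add_pos_of_nonneg_of_pos ENNReal.toReal_nonneg (by positivity)
  have hri : ∀ j, 0 < (r j)⁻¹ := fun j => inv_pos.2 (hr0 j)
  have hri1 : ∀ j, 1 ≤ (r j)⁻¹ := fun j => (one_le_inv₀ (hr0 j)).2 (hr1 j)
  have hs_fin : ∀ᵐ ω ∂P, ∀ n, s n ω ≠ ∞ := hs_sum.mono fun ω hω n =>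
    ((ENNReal.le_tsum n).trans_lt hω).ne
  have hσs : ∀ᵐ ω ∂P, Summable fun n => σ n ω := hs_sum.mono fun ω hω =>
    (ENNReal.summable_toReal hω.ne).add summable_geometric_two
  have heσ : ∀ n (f : Ω → ℝ≥0∞), Measurable[ℱ n] f →
      ∫⁻ ω, f ω * ENNReal.ofReal (e n ω) ∂P
        ≤ ∫⁻ ω, f ω * ENNReal.ofReal (σ n ω ^ 2) ∂P := by
    intro n f hf
    refine (he n f hf).trans (lintegral_mono_ae ?_)
    filter_upwards [hs_fin] with ω hω
    gcongr
    rw [ENNReal.ofReal_pow (hσ0 n ω).le]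
    gcongr
    rw [← ENNReal.ofReal_toReal (hω n)]
    exact ENNReal.ofReal_le_ofReal (le_add_of_nonneg_right (by positivity))
  have hkm : ∀ j n, Measurable[ℱ n] fun ω => (1 + σ n ω) * t j n ω + ((r j)⁻¹ - 1) * u j n ω
      + (r j)⁻¹ * (σ n ω ^ 2 + σ n ω) := fun j n =>
    (((measurable_const.add (hσ n)).mul (ht j n)).add (measurable_const.mul (hu j n))).add
      (measurable_const.mul (((hσ n).pow_const 2).add (hσ n)))
  refine robbins_siegmund ℱ (α := fun n ω => ∑ j, (r j)⁻¹ * u j n ω) (θ := θ) (χ := σ)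
    (η := fun n ω => ∑ j, (r j)⁻¹ * (σ n ω ^ 2 + σ n ω))
    (fun n => Finset.measurable_sum _ fun j _ => measurable_const.mul (hu j n)) hθ hσ
    (fun n => Finset.measurable_sum _ fun j _ =>
      measurable_const.mul (((hσ n).pow_const 2).add (hσ n)))
    (fun n ω => Finset.sum_nonneg fun j _ => mul_nonneg (hri j).le (hu0 j n ω)) hθ0
    (fun n ω => (hσ0 n ω).le)
    (fun n ω => Finset.sum_nonneg fun j _ => mul_nonneg (hri j).le
      (add_nonneg (sq_nonneg _) (hσ0 n ω).le)) ?_ hσs ?_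
  · intro n f hf
    have hfm := hf.mono (ℱ.le n) le_rfl
    have hum : ∀ j, Measurable fun ω => f ω * ENNReal.ofReal ((r j)⁻¹ * u j (n + 1) ω) :=
      fun j => hfm.mul (measurable_const.mul
        ((hu j (n + 1)).mono (ℱ.le _) le_rfl)).ennreal_ofReal
    have hθm : Measurable fun ω => f ω * ENNReal.ofReal (θ n ω) :=
      hfm.mul ((hθ n).mono (ℱ.le _) le_rfl).ennreal_ofReal
    have hkm' : ∀ j, Measurable fun ω => f ω * ENNReal.ofReal ((1 + σ n ω) * t j n ω
        + ((r j)⁻¹ - 1) * u j n ω + (r j)⁻¹ * (σ n ω ^ 2 + σ n ω)) :=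
      fun j => hfm.mul ((hkm j n).mono (ℱ.le n) le_rfl).ennreal_ofReal
    have hk0 : ∀ j ω, 0 ≤ (1 + σ n ω) * t j n ω
        + ((r j)⁻¹ - 1) * u j n ω + (r j)⁻¹ * (σ n ω ^ 2 + σ n ω) := fun j ω => by
      have h1 := hσ0 n ω
      have h2 := hri j
      exact add_nonneg (add_nonneg (mul_nonneg (by positivity) (ht0 j n ω))
        (mul_nonneg (sub_nonneg.2 (hri1 j)) (hu0 j n ω))) (by positivity)
    have hpos : ∀ ω, 0 ≤ ∑ j, (r j)⁻¹ * u j (n + 1) ω := fun ω =>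
      Finset.sum_nonneg fun j _ => mul_nonneg (hri j).le (hu0 j _ ω)
    calc ∫⁻ ω, f ω * ENNReal.ofReal (∑ j, (r j)⁻¹ * u j (n + 1) ω + θ n ω) ∂P
        = ∑ j, ∫⁻ ω, f ω * ENNReal.ofReal ((r j)⁻¹ * u j (n + 1) ω) ∂P
          + ∫⁻ ω, f ω * ENNReal.ofReal (θ n ω) ∂P := by
          rw [← lintegral_finsetSum _ fun j _ => hum j, ← lintegral_add_right _ hθm]
          refine lintegral_congr fun ω => ?_
          rw [ENNReal.ofReal_add (hpos ω) (hθ0 n ω), ENNReal.ofReal_sum_of_nonneg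
            fun j _ => mul_nonneg (hri j).le (hu0 j _ ω), mul_add, Finset.mul_sum]
      _ ≤ ∑ j, ∫⁻ ω, f ω * ENNReal.ofReal ((1 + σ n ω) * t j n ω
            + ((r j)⁻¹ - 1) * u j n ω + (r j)⁻¹ * (σ n ω ^ 2 + σ n ω)) ∂P
          + ∫⁻ ω, f ω * ENNReal.ofReal (θ n ω) ∂P := by
          refine add_le_add (Finset.sum_le_sum fun j _ => ?_) le_rfl
          exact lintegral_block_le (ℱ.le n) (hEm j n) (hr0 j) (hr1 j) (hE j n) (hEc j n) (hu j n)
            (ht j n) (hσ n) (hu0 j n) (ht0 j n) (hσ0 n) (he0 n) (heσ n)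
            ((hon j n).mono fun ω h hω => h hω _ (hσ0 n ω)) (hoff j n) hf
      _ = ∫⁻ ω, f ω * ENNReal.ofReal (∑ j, ((1 + σ n ω) * t j n ω
            + ((r j)⁻¹ - 1) * u j n ω + (r j)⁻¹ * (σ n ω ^ 2 + σ n ω)) + θ n ω) ∂P := by
          rw [← lintegral_finsetSum _ fun j _ => hkm' j, ← lintegral_add_right _ hθm]
          refine lintegral_congr fun ω => ?_
          rw [ENNReal.ofReal_add (Finset.sum_nonneg fun j _ => hk0 j ω) (hθ0 n ω),
            ENNReal.ofReal_sum_of_nonneg fun j _ => hk0 j ω, mul_add, Finset.mul_sum]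
      _ ≤ _ := by
          refine lintegral_mono fun ω => ?_
          refine mul_le_mul_right (ENNReal.ofReal_le_ofReal ?_) _
          -- The unweighted sums of `u` cancel between `hdec` and the inactive parts; the surplus `σ
          -- * ∑ t` is at most `σ` times the weighted sum since all weights are at least `1`.
          have h1 := hdec n ω
          have h2 := hσ0 n ω
          have h3 : ∑ j, u j n ω ≤ ∑ j, (r j)⁻¹ * u j n ω :=
            Finset.sum_le_sum fun j _ => le_mul_of_one_le_left (hu0 j n ω) (hri1 j)
          simp only [Finset.sum_add_distrib, sub_mul, one_mul, Finset.sum_sub_distrib,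
            ← Finset.mul_sum]
          have h4 := mul_le_mul_of_nonneg_left h1 h2.le
          have h5 := mul_le_mul_of_nonneg_left h3 h2.le
          have h6 := mul_nonneg h2.le (hθ0 n ω)
          nlinarith
  · filter_upwards [hσs] with ω hω
    have h2 : Summable fun n => σ n ω ^ 2 := by
      refine (hω.mul_left (∑' n, σ n ω)).of_nonneg_of_le (fun n => sq_nonneg _) fun n => ?_
      rw [sq]
      exact mul_le_mul_of_nonneg_right (hω.le_tsum n fun k _ => (hσ0 k ω).le) (hσ0 n ω).le
    exact summable_sum fun j _ => (h2.add hω).mul_left _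

end RandomSweeping

/-! ### Weak limits as random variables. -/

section WeakConvergence

/-- A function into a separable Hilbert space is measurable if it is so scalarly. -/
theorem measurable_of_measurable_inner {E : Type*} [NormedAddCommGroup E]
    [InnerProductSpace ℝ E] [TopologicalSpace.SeparableSpace E]
    [MeasurableSpace E] [BorelSpace E] {Ω : Type*} [MeasurableSpace Ω] {l : Ω → E}
    (hl : ∀ y, Measurable fun ω => ⟪l ω, y⟫_ℝ) : Measurable l := by
  let d := TopologicalSpace.denseSeq E
  have hd : DenseRange d := TopologicalSpace.denseRange_denseSeq E
  -- Testing against a dense sequence describes a closed ball by countably many scalar conditions;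
  -- by separability every open set is a countable union of such balls.
  have hball : ∀ q : E, ∀ r : ℝ, 0 < r → MeasurableSet (l ⁻¹' Metric.closedBall q r) := by
    intro q r hr
    have e : l ⁻¹' Metric.closedBall q r
        = ⋂ n, {ω | ⟪l ω, d n⟫_ℝ - ⟪q, d n⟫_ℝ ≤ r * ‖d n‖} := by
      ext ω
      simp only [mem_preimage, mem_closedBall_iff_norm, mem_iInter, mem_ofPred_eq,
        ← inner_sub_left]
      constructor
      · intro h n
        exact (real_inner_le_norm _ _).trans (by gcongr)
      · intro h
        have h2 : ∀ y, ⟪l ω - q, y⟫_ℝ ≤ r * ‖y‖ := fun y =>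
          hd.induction_on (p := fun y => ⟪l ω - q, y⟫_ℝ ≤ r * ‖y‖) y
            (isClosed_le (by fun_prop) (by fun_prop)) h
        have h3 := h2 (l ω - q)
        rw [real_inner_self_eq_norm_sq] at h3
        by_contra! hlt
        nlinarith
    rw [e]
    exact MeasurableSet.iInter fun n =>
      measurableSet_le ((hl _).sub measurable_const) measurable_const
  refine measurable_of_isOpen fun U hU => ?_
  have e : l ⁻¹' U = ⋃ (n : ℕ) (k : ℕ) (_ : Metric.closedBall (d n) (1 / ((k : ℝ) + 1)) ⊆ U),
      l ⁻¹' Metric.closedBall (d n) (1 / ((k : ℝ) + 1)) := by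
    ext ω
    simp only [mem_preimage, mem_iUnion, exists_prop]
    constructor
    · intro h
      obtain ⟨δ, hδ, hb⟩ := Metric.isOpen_iff.1 hU _ h
      obtain ⟨k, hk⟩ := exists_nat_one_div_lt (half_pos hδ)
      have hk0 : (0 : ℝ) < 1 / ((k : ℝ) + 1) := by positivity
      obtain ⟨n, hn⟩ := hd.exists_dist_lt (l ω) hk0
      refine ⟨n, k, fun z hz => hb ?_, Metric.mem_closedBall.2 hn.le⟩
      have h1 := Metric.mem_closedBall.1 hz
      have h2 := dist_triangle z (d n) (l ω)
      rw [dist_comm (d n)] at h2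
      rw [Metric.mem_ball]
      linarith
    · rintro ⟨n, k, hsub, hmem⟩
      exact hsub hmem
  rw [e]
  exact MeasurableSet.iUnion fun n => MeasurableSet.iUnion fun k => MeasurableSet.iUnion fun _ =>
    hball _ _ (by positivity)

variable {E : Type*} [NormedAddCommGroup E] [InnerProductSpace ℝ E] [CompleteSpace E]

theorem weakTendsto_iff_inner {u : ℕ → E} {l : E} :
    WeakTendsto u l ↔ ∀ y, Tendsto (fun n => ⟪u n, y⟫_ℝ) atTop (𝓝 ⟪l, y⟫_ℝ) := by
  have hinj : Function.Injective (topDualPairing ℝ E).flip := by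
    refine (injective_iff_map_eq_zero _).2 fun x hx => ?_
    have h : ⟪x, x⟫_ℝ = 0 := LinearMap.congr_fun hx (InnerProductSpace.toDual ℝ E x)
    exact inner_self_eq_zero.1 h
  have h1 : WeakTendsto u l ↔
      ∀ f : StrongDual ℝ E, Tendsto (fun n => f (u n)) atTop (𝓝 (f l)) :=
    WeakBilin.tendsto_iff_forall_eval_tendsto _ hinj
  rw [h1, (InnerProductSpace.toDual ℝ E).surjective.forall]
  simp only [InnerProductSpace.toDual_apply_apply, real_inner_comm]

/-- Bounded operators are weakly continuous: move `A` to its adjoint. This serves for projections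
and coordinates. -/
theorem tendsto_inner_map {F : Type*} [NormedAddCommGroup F] [InnerProductSpace ℝ F]
    [CompleteSpace F] (A : E →L[ℝ] F) {u : ℕ → E} {l : E}
    (h : ∀ y, Tendsto (fun n => ⟪u n, y⟫_ℝ) atTop (𝓝 ⟪l, y⟫_ℝ)) (y : F) :
    Tendsto (fun n => ⟪A (u n), y⟫_ℝ) atTop (𝓝 ⟪A l, y⟫_ℝ) := by
  simpa only [ContinuousLinearMap.adjoint_inner_right] using h (ContinuousLinearMap.adjoint A y)

/-- Almost sure weak convergence to points of `S` yields an `S`-valued weak limit that is a random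
variable. -/
theorem weaklyConvergesTo_of_ae [TopologicalSpace.SeparableSpace E] [MeasurableSpace E]
    [BorelSpace E] {Ω : Type*} [MeasurableSpace Ω] {P : Measure Ω} {u : ℕ → Ω → E}
    (hu : ∀ n, Measurable (u n)) {S : Set E} (hS : S.Nonempty)
    (h : ∀ᵐ ω ∂P, ∃ l ∈ S, ∀ y, Tendsto (fun n => ⟪u n ω, y⟫_ℝ) atTop (𝓝 ⟪l, y⟫_ℝ)) :
    WeaklyConvergesTo P u S := by
  classical
  obtain ⟨s₀, hs₀⟩ := hS
  -- The exceptional set is enlarged to a measurable null set, on which the limit is given the value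
  -- `s₀`; it is then `S`-valued everywhere and scalarly a limit of measurable functions.
  obtain ⟨N, hN, hNm, hN0⟩ := exists_measurable_superset_of_null (ae_iff.1 h)
  have hgood : ∀ ω ∈ Nᶜ, ∃ l ∈ S, ∀ y,
      Tendsto (fun n => ⟪u n ω, y⟫_ℝ) atTop (𝓝 ⟪l, y⟫_ℝ) := fun ω hω => by
    by_contra hcon
    exact hω (hN hcon)
  choose! l hlS hl using hgood
  refine ⟨fun ω => if ω ∈ N then s₀ else l ω, measurable_of_measurable_inner fun y => ?_,
    fun ω => ?_, ?_⟩
  · refine measurable_of_tendsto_metrizable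
      (f := fun n ω => if ω ∈ N then ⟪s₀, y⟫_ℝ else ⟪u n ω, y⟫_ℝ)
      (fun n => Measurable.ite hNm measurable_const ?_) ?_
    · exact (by fun_prop : Continuous fun v : E => ⟪v, y⟫_ℝ).measurable.comp (hu n)
    · rw [tendsto_pi_nhds]
      intro ω
      by_cases hω : ω ∈ N
      · simp [hω]
      · simpa [hω] using hl ω hω y
  · by_cases hω : ω ∈ N
    · simpa [hω] using hs₀
    · simpa [hω] using hlS ω hω
  · filter_upwards [compl_mem_ae_iff.2 hN0] with ω hω
    rw [weakTendsto_iff_inner]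
    have : ω ∉ N := hω
    simpa [this] using hl ω hω

end WeakConvergence

/-- A sequence that is refreshed infinitely often from a convergent sequence converges to the same
limit. -/
theorem tendsto_of_frequently_refreshed {X : Type*} [TopologicalSpace X] {ζ v : ℕ → X} {l : X}
    {act : ℕ → Prop} (hact : ∃ᶠ n in atTop, act n) (hon : ∀ n, act n → ζ (n + 1) = v n)
    (hoff : ∀ n, ¬act n → ζ (n + 1) = ζ n) (hv : Tendsto v atTop (𝓝 l)) :
    Tendsto ζ atTop (𝓝 l) := by
  intro U hU
  obtain ⟨N, hN⟩ := eventually_atTop.1 (hv hU)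
  -- From the first activation after `N` on, `ζ` only holds values `v k` with `k ≥ N`.
  obtain ⟨n₀, hn₀, h₀⟩ := frequently_atTop.1 hact N
  refine mem_map.2 (mem_atTop_sets.2 ⟨n₀ + 1, fun n hn => ?_⟩)
  induction n, hn using Nat.le_induction with
  | base =>
    rw [mem_preimage, hon _ h₀]
    exact hN _ hn₀
  | succ n hn ih =>
    by_cases h : act n
    · rw [mem_preimage, hon _ h]
      exact hN _ (by omega)
    · rw [mem_preimage, hoff _ h]
      exact ih

/-! ### Perturbation estimates for one step. -/

section Steps

variable {E : Type*} [NormedAddCommGroup E] [InnerProductSpace ℝ E]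

/-- Young's inequality with a free parameter, later matched to the conditional size of the error. -/
theorem norm_add_sq_le_of_pos (u v : E) {σ : ℝ} (hσ : 0 < σ) :
    ‖u + v‖ ^ 2 ≤ (1 + σ) * ‖u‖ ^ 2 + (1 + σ⁻¹) * ‖v‖ ^ 2 := by
  have h1 : 2 * ⟪u, v⟫_ℝ ≤ σ * ‖u‖ ^ 2 + σ⁻¹ * ‖v‖ ^ 2 := by
    have h2 := real_inner_le_norm u v
    have h3 : 0 ≤ σ⁻¹ * (σ * ‖u‖ - ‖v‖) ^ 2 := by positivity
    have h4 : σ⁻¹ * (σ * ‖u‖ - ‖v‖) ^ 2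
        = σ * ‖u‖ ^ 2 + σ⁻¹ * ‖v‖ ^ 2 - 2 * (‖u‖ * ‖v‖) := by
      field_simp
      ring
    linarith
  rw [norm_add_sq_real]
  linarith

/-- The inexact relaxed step on an activated block, compared with the exact one. -/
theorem norm_inexact_step_sub_sq_le {J : E → E} (hJ : ∀ u v, ‖J u - J v‖ ≤ ‖u - v‖)
    {r σ : ℝ} (hr0 : 0 ≤ r) (hr2 : r ≤ 2) (hσ : 0 < σ) (x q a c z : E) :
    ‖x + r • (J ((2 : ℝ) • (q + c) - x) + a - (q + c)) - z‖ ^ 2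
      ≤ (1 + σ) * ‖x + r • (J ((2 : ℝ) • q - x) - q) - z‖ ^ 2
        + (1 + σ⁻¹) * (72 * (‖a‖ ^ 2 + ‖c‖ ^ 2)) := by
  set e := J ((2 : ℝ) • (q + c) - x) - J ((2 : ℝ) • q - x) + a - c with he
  have e1 : x + r • (J ((2 : ℝ) • (q + c) - x) + a - (q + c)) - z
      = (x + r • (J ((2 : ℝ) • q - x) - q) - z) + r • e := by
    rw [he]
    simp only [smul_sub, smul_add]
    abel
  have e2 : ‖e‖ ≤ ‖a‖ + 3 * ‖c‖ := by
    have h1 : ‖J ((2 : ℝ) • (q + c) - x) - J ((2 : ℝ) • q - x)‖ ≤ 2 * ‖c‖ := by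
      refine (hJ _ _).trans (le_of_eq ?_)
      have : (2 : ℝ) • (q + c) - x - ((2 : ℝ) • q - x) = (2 : ℝ) • c := by
        rw [smul_add]; abel
      rw [this, norm_smul, Real.norm_two]
    have h2 := norm_sub_le (J ((2 : ℝ) • (q + c) - x) - J ((2 : ℝ) • q - x) + a) c
    have h3 := norm_add_le (J ((2 : ℝ) • (q + c) - x) - J ((2 : ℝ) • q - x)) a
    linarith
  -- The error `c` enters twice through the reflection and once directly, whence `3 * ‖c‖`; then `4
  -- * (α + 3 * β) ^ 2 ≤ 8 * α ^ 2 + 72 * β ^ 2`.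
  have e3 : ‖r • e‖ ^ 2 ≤ 72 * (‖a‖ ^ 2 + ‖c‖ ^ 2) := by
    have h1 : ‖r • e‖ ≤ 2 * (‖a‖ + 3 * ‖c‖) := by
      rw [norm_smul, Real.norm_of_nonneg hr0]
      exact mul_le_mul hr2 e2 (norm_nonneg _) (by norm_num)
    have h2 : ‖r • e‖ ^ 2 ≤ (2 * (‖a‖ + 3 * ‖c‖)) ^ 2 := by gcongr
    nlinarith [sq_nonneg (‖a‖ - 3 * ‖c‖), sq_nonneg ‖a‖]
  rw [e1]
  refine (norm_add_sq_le_of_pos _ _ hσ).trans ?_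
  have := inv_pos.2 hσ
  gcongr

end Steps

/-- A weighted second moment of the errors is controlled by the square of the sum of the roots of
their conditional second moments. -/
theorem lintegral_mul_sum_le {Ω κ : Type*} [Fintype κ] {m mΩ : MeasurableSpace Ω} {P : Measure Ω}
    [IsFiniteMeasure P] (hm : m ≤ mΩ) {g : κ → Ω → ℝ≥0∞} (hg : ∀ k, Measurable (g k))
    {f : Ω → ℝ≥0∞} (hf : Measurable[m] f) :
    ∫⁻ ω, f ω * ∑ k, g k ω ∂P
      ≤ ∫⁻ ω, f ω * (∑ k, condLExp m P (g k) ω ^ (1 / 2 : ℝ)) ^ 2 ∂P := by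
  have hfm := hf.mono hm le_rfl
  calc ∫⁻ ω, f ω * ∑ k, g k ω ∂P = ∑ k, ∫⁻ ω, f ω * g k ω ∂P := by
        simp only [Finset.mul_sum]
        exact lintegral_finsetSum _ fun k _ => hfm.fun_mul (hg k)
    _ = ∑ k, ∫⁻ ω, f ω * condLExp m P (g k) ω ∂P :=
        Finset.sum_congr rfl fun k _ => (lintegral_mul_condLExp hm (hg k) hf).symm
    _ = ∫⁻ ω, f ω * ∑ k, condLExp m P (g k) ω ∂P := by
        simp only [Finset.mul_sum]
        exact (lintegral_finsetSum _ fun k _ => hfm.fun_mul (measurable_condLExp' _ _ _)).symm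
    _ ≤ _ := by
        refine lintegral_mono fun ω => mul_le_mul_right ?_ _
        rw [sq, Finset.sum_mul]
        refine Finset.sum_le_sum fun k _ => ?_
        calc condLExp m P (g k) ω
            = condLExp m P (g k) ω ^ (1 / 2 : ℝ) * condLExp m P (g k) ω ^ (1 / 2 : ℝ) := by
              rw [← ENNReal.rpow_add_of_nonneg _ _ (by norm_num) (by norm_num)]
              norm_num
          _ ≤ _ := mul_le_mul_right (Finset.single_le_sum
              (f := fun k => condLExp m P (g k) ω ^ (1 / 2 : ℝ)) (fun _ _ => zero_le)
              (Finset.mem_univ k)) _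

/-! ### Stochastic Fejér monotonicity for block iterations. -/

section BlockSweeping

variable {m p : ℕ} {H : Fin m → Type*} {G : Fin p → Type*}
  [∀ i, NormedAddCommGroup (H i)] [∀ k, NormedAddCommGroup (G k)]

/-- The squared norms of the blocks of a vector. -/
noncomputable def blockSq (X : WithLp 2 (PiLp 2 H × PiLp 2 G)) : Fin m ⊕ Fin p → ℝ :=
  Sum.elim (fun i => ‖X.fst i‖ ^ 2) fun k => ‖X.snd k‖ ^ 2

theorem blockSq_nonneg (X : WithLp 2 (PiLp 2 H × PiLp 2 G)) (j : Fin m ⊕ Fin p) :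
    0 ≤ blockSq X j := by
  rcases j with i | k
  · exact sq_nonneg ‖X.fst i‖
  · exact sq_nonneg ‖X.snd k‖

theorem continuous_blockSq (j : Fin m ⊕ Fin p) :
    Continuous fun X : WithLp 2 (PiLp 2 H × PiLp 2 G) => blockSq X j := by
  rcases j with i | k
  · change Continuous fun X : WithLp 2 (PiLp 2 H × PiLp 2 G) => ‖X.fst i‖ ^ 2
    fun_prop
  · change Continuous fun X : WithLp 2 (PiLp 2 H × PiLp 2 G) => ‖X.snd k‖ ^ 2
    fun_prop

variable [∀ i, InnerProductSpace ℝ (H i)] [∀ k, InnerProductSpace ℝ (G k)]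

theorem sum_blockSq (X : WithLp 2 (PiLp 2 H × PiLp 2 G)) : ∑ j, blockSq X j = ‖X‖ ^ 2 := by
  rw [norm_sq_eq_sum_blocks, Fintype.sum_sum_type]
  rfl

/-- Links the weighted block sums of the probabilistic estimate to the metric `W` of Opial's lemma.
-/
theorem inner_blockScale_self (r : Fin m ⊕ Fin p → ℝ) (X : WithLp 2 (PiLp 2 H × PiLp 2 G)) :
    ⟪X, blockScale (fun i => r (Sum.inl i)) (fun k => r (Sum.inr k)) X⟫_ℝ
      = ∑ j, r j * blockSq X j := by
  rw [inner_blockScale_right, Fintype.sum_sum_type]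
  simp only [real_inner_self_eq_norm_sq]
  rfl

/-- Almost sure Fejér property of an inexact relaxed fixed point iteration of a firmly nonexpansive
operator with random sweeping of the blocks. -/
theorem ae_fejer_of_random_sweeping {Ω : Type*} {mΩ : MeasurableSpace Ω} {P : Measure Ω}
    [IsFiniteMeasure P] (ℱ : Filtration ℕ mΩ)
    {T : WithLp 2 (PiLp 2 H × PiLp 2 G) → WithLp 2 (PiLp 2 H × PiLp 2 G)} (hT : IsFirm T)
    {z : WithLp 2 (PiLp 2 H × PiLp 2 G)} (hz : T z = z)
    {X : ℕ → Ω → WithLp 2 (PiLp 2 H × PiLp 2 G)}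
    (hX : ∀ n (φ : WithLp 2 (PiLp 2 H × PiLp 2 G) → ℝ), Continuous φ →
      Measurable[ℱ n] fun ω => φ (X n ω))
    {ρ : ℕ → ℝ} (hρ0 : ∀ n, 0 ≤ ρ n) (hρ2 : ∀ n, ρ n ≤ 2)
    {E : Fin m ⊕ Fin p → ℕ → Set Ω} (hEm : ∀ j n, MeasurableSet (E j n))
    {r : Fin m ⊕ Fin p → ℝ} (hr0 : ∀ j, 0 < r j) (hr1 : ∀ j, r j ≤ 1)
    (hE : ∀ j n (f : Ω → ℝ≥0∞), Measurable[ℱ n] f →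
      ∫⁻ ω in E j n, f ω ∂P = ENNReal.ofReal (r j) * ∫⁻ ω, f ω ∂P)
    (hEc : ∀ j n (f : Ω → ℝ≥0∞), Measurable[ℱ n] f →
      ∫⁻ ω in (E j n)ᶜ, f ω ∂P = ENNReal.ofReal (1 - r j) * ∫⁻ ω, f ω ∂P)
    {e : ℕ → Ω → ℝ} {s : ℕ → Ω → ℝ≥0∞} (hs : ∀ n, Measurable[ℱ n] (s n))
    (he0 : ∀ n ω, 0 ≤ e n ω)
    (he : ∀ n (f : Ω → ℝ≥0∞), Measurable[ℱ n] f →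
      ∫⁻ ω, f ω * ENNReal.ofReal (e n ω) ∂P ≤ ∫⁻ ω, f ω * s n ω ^ 2 ∂P)
    (hs_sum : ∀ᵐ ω ∂P, ∑' n, s n ω < ∞)
    (hon : ∀ j n, ∀ᵐ ω ∂P, ω ∈ E j n → ∀ σ : ℝ, 0 < σ → blockSq (X (n + 1) ω - z) j
      ≤ (1 + σ) * blockSq (X n ω + ρ n • (T (X n ω) - X n ω) - z) j + (1 + σ⁻¹) * e n ω)
    (hoff : ∀ j n, ∀ᵐ ω ∂P, ω ∉ E j n → blockSq (X (n + 1) ω - z) j ≤ blockSq (X n ω - z) j) :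
    ∀ᵐ ω ∂P, (∃ l, Tendsto (fun n => ⟪X n ω - z,
      blockScale (fun i => (r (Sum.inl i))⁻¹) (fun k => (r (Sum.inr k))⁻¹) (X n ω - z)⟫_ℝ)
        atTop (𝓝 l)) ∧ Summable fun n => ρ n * (2 - ρ n) * ‖T (X n ω) - X n ω‖ ^ 2 := by
  have hTc := hT.continuous
  simp only [inner_blockScale_self fun j => (r j)⁻¹]
  refine ae_tendsto_of_random_sweeping (P := P) ℱ hEm hr0 hr1 hE hEc
    (u := fun j n ω => blockSq (X n ω - z) j)
    (t := fun j n ω => blockSq (X n ω + ρ n • (T (X n ω) - X n ω) - z) j)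
    (fun j n => hX n (fun v => blockSq (v - z) j) ((continuous_blockSq j).comp (by fun_prop)))
    (fun j n => hX n (fun v => blockSq (v + ρ n • (T v - v) - z) j)
      ((continuous_blockSq j).comp (by fun_prop)))
    (fun n => hX n (fun v => ρ n * (2 - ρ n) * ‖T v - v‖ ^ 2) (by fun_prop)) hs
    (fun j n ω => blockSq_nonneg _ j) (fun j n ω => blockSq_nonneg _ j)
    (fun n ω => mul_nonneg (mul_nonneg (hρ0 n) (sub_nonneg.2 (hρ2 n))) (sq_nonneg _)) he0 he
    hs_sum hon hoff fun n ω => ?_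
  -- Unweighted block sums are full squared norms, so the required decrease is that of the
  -- deterministic relaxed step.
  rw [sum_blockSq, sum_blockSq]
  have := hT.norm_relaxation_sub_sq_le (hρ0 n) hz (X n ω)
  linarith

end BlockSweeping

theorem Pattern.coeff_of_eq_one {m p : ℕ} {e : Pattern m p} {j : Fin m ⊕ Fin p} (h : e.1 j = 1) :
    e.coeff j = 1 := by
  simp [Pattern.coeff, h]

theorem Pattern.coeff_of_ne_one {m p : ℕ} {e : Pattern m p} {j : Fin m ⊕ Fin p} (h : e.1 j ≠ 1) :
    e.coeff j = 0 := by
  have : e.1 j = 0 := by omega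
  simp [Pattern.coeff, this]

theorem Pattern.measurableSet_eq_one {m p : ℕ} (j : Fin m ⊕ Fin p) :
    MeasurableSet {e : Pattern m p | e.1 j = 1} :=
  ((measurable_pi_apply j).comp measurable_subtype_coe) (measurableSet_singleton 1)

/-- A common `[0,+∞]`-valued summable bound for the conditional second moments of four error
sequences. -/
theorem exists_error_bound {Ω E F : Type*} {mΩ : MeasurableSpace Ω} {P : Measure Ω}
    [IsFiniteMeasure P] [NormedAddCommGroup E] [MeasurableSpace E] [OpensMeasurableSpace E]
    [NormedAddCommGroup F] [MeasurableSpace F] [OpensMeasurableSpace F] (ℱ : Filtration ℕ mΩ)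
    {a c : ℕ → Ω → E} {b d : ℕ → Ω → F}
    (ha : ∀ n, Measurable (a n)) (hb : ∀ n, Measurable (b n))
    (hc : ∀ n, Measurable (c n)) (hd : ∀ n, Measurable (d n))
    (ha_sum : SummableErrors P ℱ a) (hb_sum : SummableErrors P ℱ b)
    (hc_sum : SummableErrors P ℱ c) (hd_sum : SummableErrors P ℱ d) :
    ∃ s : ℕ → Ω → ℝ≥0∞, (∀ n, Measurable[ℱ n] (s n)) ∧
      (∀ n (f : Ω → ℝ≥0∞), Measurable[ℱ n] f →
        ∫⁻ ω, f ω * ENNReal.ofReal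
          (72 * (‖a n ω‖ ^ 2 + ‖b n ω‖ ^ 2 + ‖c n ω‖ ^ 2 + ‖d n ω‖ ^ 2)) ∂P
          ≤ ∫⁻ ω, f ω * s n ω ^ 2 ∂P) ∧
      ∀ᵐ ω ∂P, ∑' n, s n ω < ∞ := by
  let g : ℕ → Fin 4 → Ω → ℝ≥0∞ := fun n => ![fun ω => ‖a n ω‖ₑ ^ 2, fun ω => ‖b n ω‖ₑ ^ 2,
    fun ω => ‖c n ω‖ₑ ^ 2, fun ω => ‖d n ω‖ₑ ^ 2]
  have hg : ∀ n k, Measurable (g n k) := fun n k => by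
    fin_cases k
    · exact (ha n).enorm.pow_const 2
    · exact (hb n).enorm.pow_const 2
    · exact (hc n).enorm.pow_const 2
    · exact (hd n).enorm.pow_const 2
  let e : ℕ → Ω → ℝ := fun n ω => 72 * (‖a n ω‖ ^ 2 + ‖b n ω‖ ^ 2 + ‖c n ω‖ ^ 2 + ‖d n ω‖ ^ 2)
  -- The factor `9` works because `72 ≤ 9 ^ 2`.
  let s : ℕ → Ω → ℝ≥0∞ := fun n ω => 9 * ∑ k, condLExp (ℱ n) P (g n k) ω ^ (1 / 2 : ℝ)
  have hs : ∀ n, Measurable[ℱ n] (s n) := fun n => measurable_const.mul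
    (Finset.measurable_sum _ fun k _ => (measurable_condLExp _ _ _).pow_const _)
  have heg : ∀ n ω, ENNReal.ofReal (e n ω) = 72 * ∑ k, g n k ω := fun n ω => by
    have hsum : ∑ k, g n k ω
        = ‖a n ω‖ₑ ^ 2 + ‖b n ω‖ₑ ^ 2 + ‖c n ω‖ₑ ^ 2 + ‖d n ω‖ₑ ^ 2 := by
      rw [Fin.sum_univ_four]
      rfl
    rw [hsum, ENNReal.ofReal_mul (by norm_num), ENNReal.ofReal_add (by positivity) (by positivity),
      ENNReal.ofReal_add (by positivity) (by positivity),
      ENNReal.ofReal_add (by positivity) (by positivity)]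
    simp only [ENNReal.ofReal_pow (norm_nonneg _), ofReal_norm]
    norm_num
  have he : ∀ n (f : Ω → ℝ≥0∞), Measurable[ℱ n] f →
      ∫⁻ ω, f ω * ENNReal.ofReal (e n ω) ∂P ≤ ∫⁻ ω, f ω * s n ω ^ 2 ∂P := by
    intro n f hf
    calc ∫⁻ ω, f ω * ENNReal.ofReal (e n ω) ∂P = ∫⁻ ω, (f ω * 72) * ∑ k, g n k ω ∂P :=
          lintegral_congr fun ω => by rw [heg, mul_assoc]
      _ ≤ ∫⁻ ω, (f ω * 72) * (∑ k, condLExp (ℱ n) P (g n k) ω ^ (1 / 2 : ℝ)) ^ 2 ∂P :=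
          lintegral_mul_sum_le (ℱ.le n) (hg n) (hf.mul measurable_const)
      _ ≤ _ := lintegral_mono fun ω => by
          simp only [s]
          rw [mul_assoc, mul_pow]
          gcongr
          norm_num
  have hs_sum : ∀ᵐ ω ∂P, ∑' n, s n ω < ∞ := by
    filter_upwards [ha_sum, hb_sum, hc_sum, hd_sum] with ω h1 h2 h3 h4
    simp only [s, Fin.sum_univ_four]
    rw [ENNReal.tsum_mul_left, ENNReal.tsum_add, ENNReal.tsum_add, ENNReal.tsum_add]
    exact ENNReal.mul_lt_top (by norm_num)
      (ENNReal.add_lt_top.2 ⟨ENNReal.add_lt_top.2 ⟨ENNReal.add_lt_top.2 ⟨h1, h2⟩, h3⟩, h4⟩)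
  exact ⟨s, hs, he, hs_sum⟩

theorem Pattern.coeff_eq_zero_or_one {m p : ℕ} (e : Pattern m p) (j : Fin m ⊕ Fin p) :
    e.coeff j ≠ 1 → e.coeff j = 0 := fun h =>
  Pattern.coeff_of_ne_one fun h' => h (Pattern.coeff_of_eq_one h')

/-- Blocks that are refreshed infinitely often from a weakly convergent sequence, up to errors
tending weakly to zero, converge weakly. -/
theorem tendsto_inner_of_block_refresh {ι : Type*} [Fintype ι] {E : ι → Type*}
    [∀ i, NormedAddCommGroup (E i)] [∀ i, InnerProductSpace ℝ (E i)] [∀ i, CompleteSpace (E i)]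
    {z q c : ℕ → PiLp 2 E} {κ : ℕ → ι → ℝ} (hκ : ∀ i, ∃ᶠ n in atTop, κ n i = 1)
    (hκ0 : ∀ n i, κ n i ≠ 1 → κ n i = 0)
    (hstep : ∀ n i, z (n + 1) i = z n i + κ n i • (q n i + c n i - z n i)) {l : PiLp 2 E}
    (hq : ∀ v, Tendsto (fun n => ⟪q n, v⟫_ℝ) atTop (𝓝 ⟪l, v⟫_ℝ))
    (hc : ∀ v, Tendsto (fun n => ⟪c n, v⟫_ℝ) atTop (𝓝 ⟪0, v⟫_ℝ)) (v : PiLp 2 E) :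
    Tendsto (fun n => ⟪z n, v⟫_ℝ) atTop (𝓝 ⟪l, v⟫_ℝ) := by
  simp only [PiLp.inner_apply]
  refine tendsto_finsetSum _ fun i _ => ?_
  -- Refreshing is applied to the scalar sequence of each block, since different blocks are
  -- activated at different times.
  have hsum := (tendsto_inner_map (PiLp.proj 2 E i (𝕜 := ℝ)) hq (v i)).add
    (tendsto_inner_map (PiLp.proj 2 E i (𝕜 := ℝ)) hc (v i))
  rw [map_zero, inner_zero_left, add_zero] at hsum
  refine tendsto_of_frequently_refreshed (hκ i) (fun n hn => ?_) (fun n hn => ?_) hsum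
  · rw [hstep n i, hn, one_smul, add_sub_cancel, inner_add_left]
    rfl
  · rw [hstep n i, hκ0 n i hn, zero_smul, add_zero]

/-- The filtration generated by a pair of processes. -/
def historyFiltration {Ω E F : Type*} {mΩ : MeasurableSpace Ω} [MeasurableSpace E]
    [MeasurableSpace F] {x : ℕ → Ω → E} {y : ℕ → Ω → F} (hx : ∀ n, Measurable (x n))
    (hy : ∀ n, Measurable (y n)) : Filtration ℕ mΩ where
  seq := history x y
  mono' _ _ hij := biSup_mono fun _ hk => Finset.range_mono (Nat.succ_le_succ hij) hk
  le' _ := iSup₂_le fun j _ => sup_le (hx j).comap_le (hy j).comap_le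

theorem measurable_history {Ω E F : Type*} [MeasurableSpace E]
    [MeasurableSpace F] (x : ℕ → Ω → E) (y : ℕ → Ω → F) (n : ℕ) :
    Measurable[history x y n] (x n) ∧ Measurable[history x y n] (y n) := by
  have h : MeasurableSpace.comap (x n) inferInstance ⊔ MeasurableSpace.comap (y n) inferInstance
      ≤ history x y n :=
    le_biSup (fun j => MeasurableSpace.comap (x j) inferInstance
      ⊔ MeasurableSpace.comap (y j) inferInstance) (Finset.self_mem_range_succ n)
  exact ⟨Measurable.of_comap_le (le_sup_left.trans h),
    Measurable.of_comap_le (le_sup_right.trans h)⟩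

end BlockDR

/-! ### The convergence theorem. -/

theorem corollary5p3
    {m p : ℕ} {H : Fin m → Type*} {G : Fin p → Type*}
    [∀ i, NormedAddCommGroup (H i)] [∀ i, InnerProductSpace ℝ (H i)] [∀ i, CompleteSpace (H i)]
    [∀ i, TopologicalSpace.SeparableSpace (H i)]
    [∀ i, MeasurableSpace (H i)] [∀ i, BorelSpace (H i)]
    [∀ k, NormedAddCommGroup (G k)] [∀ k, InnerProductSpace ℝ (G k)] [∀ k, CompleteSpace (G k)]
    [∀ k, TopologicalSpace.SeparableSpace (G k)]
    [∀ k, MeasurableSpace (G k)] [∀ k, BorelSpace (G k)]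
    {Ω : Type*} [MeasurableSpace Ω] (P : Measure Ω) [IsProbabilityMeasure P]
    -- the operators
    (A : ∀ i, H i → Set (H i)) (hA : ∀ i, BlockDR.IsMaximallyMonotone (A i))
    (B : ∀ k, G k → Set (G k)) (hB : ∀ k, BlockDR.IsMaximallyMonotone (B k))
    (L : ∀ k i, H i →L[ℝ] G k)
    (hF : (BlockDR.primalSolutions A B L).Nonempty)
    -- the parameters
    (γ : ℝ) (hγ : 0 < γ)
    (μ : ℕ → ℝ) (hμ : ∀ n, μ n ∈ Ioo (0 : ℝ) 2) (hμ_inf : 0 < ⨅ n, μ n) (hμ_sup : ⨆ n, μ n < 2)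
    -- the random variables: iterates, errors and activation patterns
    (x z a c : ℕ → Ω → PiLp 2 H) (y w b d : ℕ → Ω → PiLp 2 G)
    (ε : ℕ → Ω → BlockDR.Pattern m p)
    (hx : ∀ n, Measurable (x n)) (hz : ∀ n, Measurable (z n))
    (hy : ∀ n, Measurable (y n)) (hw : ∀ n, Measurable (w n))
    (ha : ∀ n, Measurable (a n)) (hc : ∀ n, Measurable (c n))
    (hb : ∀ n, Measurable (b n)) (hd : ∀ n, Measurable (d n))
    (hε : ∀ n, Measurable (ε n)) (hε_id : ∀ n, IdentDistrib (ε n) (ε 0) P P)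
    -- the iteration
    (hz_step : ∀ n i, ∀ᵐ ω ∂P, z (n + 1) ω i = z n ω i + (ε n ω).coeff (Sum.inl i) •
      ((BlockDR.graphProj L (x n ω) (y n ω)).fst i + c n ω i - z n ω i))
    (hx_step : ∀ n i, ∀ᵐ ω ∂P, x (n + 1) ω i = x n ω i + ((ε n ω).coeff (Sum.inl i) * μ n) •
      (BlockDR.resolvent (fun t => γ • A i t) ((2 : ℝ) • z (n + 1) ω i - x n ω i)
        + a n ω i - z (n + 1) ω i))
    (hw_step : ∀ n k, ∀ᵐ ω ∂P, w (n + 1) ω k = w n ω k + (ε n ω).coeff (Sum.inr k) •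
      ((BlockDR.graphProj L (x n ω) (y n ω)).snd k + d n ω k - w n ω k))
    (hy_step : ∀ n k, ∀ᵐ ω ∂P, y (n + 1) ω k = y n ω k + ((ε n ω).coeff (Sum.inr k) * μ n) •
      (BlockDR.resolvent (fun t => γ • B k t) ((2 : ℝ) • w (n + 1) ω k - y n ω k)
        + b n ω k - w (n + 1) ω k))
    -- the errors
    (ha_sum : BlockDR.SummableErrors P (BlockDR.history x y) a)
    (hb_sum : BlockDR.SummableErrors P (BlockDR.history x y) b)
    (hc_sum : BlockDR.SummableErrors P (BlockDR.history x y) c)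
    (hd_sum : BlockDR.SummableErrors P (BlockDR.history x y) d)
    (hc_weak : ∀ᵐ ω ∂P, BlockDR.WeakTendsto (fun n => c n ω) 0)
    (hd_weak : ∀ᵐ ω ∂P, BlockDR.WeakTendsto (fun n => d n ω) 0)
    -- the sweeping rule
    (h_indep : ∀ n, Indep (MeasurableSpace.comap (ε n) inferInstance) (BlockDR.history x y n) P)
    (h_pos : ∀ j, 0 < P {ω | (ε 0 ω).1 j = 1})
    (h_io : ∀ j, ∀ᵐ ω ∂P, ∃ᶠ n in atTop, (ε n ω).1 j = 1) :
    BlockDR.WeaklyConvergesTo P z (BlockDR.primalSolutions A B L) ∧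
    BlockDR.WeaklyConvergesTo P (fun n ω => γ⁻¹ • (w n ω - y n ω))
      (BlockDR.dualSolutions A B L) := by
  classical
  have : ∀ i, SecondCountableTopology (H i) := fun i =>
    UniformSpace.secondCountable_of_separable _
  have : ∀ k, SecondCountableTopology (G k) := fun k =>
    UniformSpace.secondCountable_of_separable _
  let T := BlockDR.drOp (BlockDR.graphSubspace L) (BlockDR.blockResolvent A B γ)
  have hT : BlockDR.IsFirm T := BlockDR.isFirm_drOp _ (BlockDR.isFirm_blockResolvent hA hB hγ)
  let X : ℕ → Ω → WithLp 2 (PiLp 2 H × PiLp 2 G) := fun n ω => WithLp.toLp 2 (x n ω, y n ω)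
  let ℱ := BlockDR.historyFiltration hx hy
  have hX : ∀ n (φ : WithLp 2 (PiLp 2 H × PiLp 2 G) → ℝ), Continuous φ →
      Measurable[ℱ n] fun ω => φ (X n ω) := fun n φ hφ => by
    have hc : Continuous fun q : PiLp 2 H × PiLp 2 G => φ (WithLp.toLp 2 q) := by fun_prop
    exact hc.measurable.comp ((BlockDR.measurable_history x y n).1.prodMk
      (BlockDR.measurable_history x y n).2)
  -- the relaxation parameters are bounded away from `0` and `2`
  have hμ_le : ∀ n, ⨅ n, μ n ≤ μ n := fun n => ciInf_le ⟨0, by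
    rintro _ ⟨n, rfl⟩; exact (hμ n).1.le⟩ n
  have hle_μ : ∀ n, μ n ≤ ⨆ n, μ n := fun n => le_ciSup ⟨2, by
    rintro _ ⟨n, rfl⟩; exact (hμ n).2.le⟩ n
  have hδ : 0 < (⨅ n, μ n) * (2 - ⨆ n, μ n) := mul_pos hμ_inf (sub_pos.2 hμ_sup)
  -- the activation events
  let E : Fin m ⊕ Fin p → ℕ → Set Ω := fun j n => {ω | (ε n ω).1 j = 1}
  have hEm' : ∀ j n, MeasurableSet[MeasurableSpace.comap (ε n) inferInstance] (E j n) :=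
    fun j n => ⟨_, BlockDR.Pattern.measurableSet_eq_one j, rfl⟩
  have hEm : ∀ j n, MeasurableSet (E j n) := fun j n => (hε n).comap_le _ (hEm' j n)
  -- Identical distribution makes the activation probabilities, hence the weights of the metric,
  -- independent of `n`.
  have hEP : ∀ j n, P (E j n) = ENNReal.ofReal (P.real (E j 0)) := fun j n => by
    rw [ofReal_measureReal]
    exact (hε_id n).measure_mem_eq (BlockDR.Pattern.measurableSet_eq_one j)
  have hr0 : ∀ j, 0 < P.real (E j 0) := fun j =>
    ENNReal.toReal_pos (h_pos j).ne' (measure_ne_top _ _)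
  have hr1 : ∀ j, P.real (E j 0) ≤ 1 := fun j => measureReal_le_one
  have hE : ∀ j n (f : Ω → ℝ≥0∞), Measurable[ℱ n] f →
      ∫⁻ ω in E j n, f ω ∂P = ENNReal.ofReal (P.real (E j 0)) * ∫⁻ ω, f ω ∂P := by
    intro j n f hf
    rw [← hEP j n]
    exact BlockDR.setLIntegral_eq_mul_of_indep (ℱ.le n) (hε n).comap_le (h_indep n) (hEm' j n) hf
  have hEc : ∀ j n (f : Ω → ℝ≥0∞), Measurable[ℱ n] f →
      ∫⁻ ω in (E j n)ᶜ, f ω ∂P = ENNReal.ofReal (1 - P.real (E j 0)) * ∫⁻ ω, f ω ∂P := by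
    intro j n f hf
    rw [BlockDR.setLIntegral_eq_mul_of_indep (ℱ.le n) (hε n).comap_le (h_indep n)
      (hEm' j n).compl hf, prob_compl_eq_one_sub (hEm j n), hEP j n,
      ENNReal.ofReal_sub _ measureReal_nonneg, ENNReal.ofReal_one]
  -- the errors
  obtain ⟨s, hs, he, hs_sum⟩ := BlockDR.exists_error_bound ℱ ha hb hc hd ha_sum hb_sum hc_sum hd_sum
  let e : ℕ → Ω → ℝ := fun n ω => 72 * (‖a n ω‖ ^ 2 + ‖b n ω‖ ^ 2 + ‖c n ω‖ ^ 2 + ‖d n ω‖ ^ 2)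
  have he0 : ∀ n ω, 0 ≤ e n ω := fun n ω => by positivity
  -- one step of the algorithm
  have hon : ∀ z₀ : WithLp 2 (PiLp 2 H × PiLp 2 G), ∀ j n, ∀ᵐ ω ∂P, ω ∈ E j n → ∀ σ : ℝ, 0 < σ →
      BlockDR.blockSq (X (n + 1) ω - z₀) j
        ≤ (1 + σ) * BlockDR.blockSq (X n ω + μ n • (T (X n ω) - X n ω) - z₀) j
          + (1 + σ⁻¹) * e n ω := by
    rintro z₀ (i | k) n
    · filter_upwards [hz_step n i, hx_step n i] with ω h1 h2 hω σ hσ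
      -- On activation the new `z` is the projected block plus `c`; substituting it turns the
      -- `x`-update into an inexact relaxed step of `T`.
      have hcoeff := BlockDR.Pattern.coeff_of_eq_one (e := ε n ω) hω
      rw [hcoeff, one_smul, add_sub_cancel] at h1
      rw [hcoeff, one_mul, h1] at h2
      change ‖x (n + 1) ω i - z₀.fst i‖ ^ 2 ≤ (1 + σ) * ‖x n ω i + μ n •
        (BlockDR.resolvent (fun t => γ • A i t)
          ((2 : ℝ) • (BlockDR.graphProj L (x n ω) (y n ω)).fst i - x n ω i)
          - (BlockDR.graphProj L (x n ω) (y n ω)).fst i + x n ω i - x n ω i) - z₀.fst i‖ ^ 2 + _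
      rw [add_sub_cancel_right, h2]
      refine (BlockDR.norm_inexact_step_sub_sq_le ((hA i).smul hγ).resolvent_nonexpansive
        (hμ n).1.le (hμ n).2.le hσ _ _ _ _ _).trans ?_
      have h3 := pow_le_pow_left₀ (norm_nonneg _) (PiLp.norm_apply_le (a n ω) i) 2
      have h4 := pow_le_pow_left₀ (norm_nonneg _) (PiLp.norm_apply_le (c n ω) i) 2
      have h5 := inv_pos.2 hσ
      gcongr
      simp only [e]
      nlinarith [sq_nonneg ‖b n ω‖, sq_nonneg ‖d n ω‖]
    · filter_upwards [hw_step n k, hy_step n k] with ω h1 h2 hω σ hσ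
      have hcoeff := BlockDR.Pattern.coeff_of_eq_one (e := ε n ω) hω
      rw [hcoeff, one_smul, add_sub_cancel] at h1
      rw [hcoeff, one_mul, h1] at h2
      change ‖y (n + 1) ω k - z₀.snd k‖ ^ 2 ≤ (1 + σ) * ‖y n ω k + μ n •
        (BlockDR.resolvent (fun t => γ • B k t)
          ((2 : ℝ) • (BlockDR.graphProj L (x n ω) (y n ω)).snd k - y n ω k)
          - (BlockDR.graphProj L (x n ω) (y n ω)).snd k + y n ω k - y n ω k) - z₀.snd k‖ ^ 2 + _
      rw [add_sub_cancel_right, h2]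
      refine (BlockDR.norm_inexact_step_sub_sq_le ((hB k).smul hγ).resolvent_nonexpansive
        (hμ n).1.le (hμ n).2.le hσ _ _ _ _ _).trans ?_
      have h3 := pow_le_pow_left₀ (norm_nonneg _) (PiLp.norm_apply_le (b n ω) k) 2
      have h4 := pow_le_pow_left₀ (norm_nonneg _) (PiLp.norm_apply_le (d n ω) k) 2
      have h5 := inv_pos.2 hσ
      gcongr
      simp only [e]
      nlinarith [sq_nonneg ‖a n ω‖, sq_nonneg ‖c n ω‖]
  have hoff : ∀ z₀ : WithLp 2 (PiLp 2 H × PiLp 2 G), ∀ j n, ∀ᵐ ω ∂P, ω ∉ E j n →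
      BlockDR.blockSq (X (n + 1) ω - z₀) j ≤ BlockDR.blockSq (X n ω - z₀) j := by
    rintro z₀ (i | k) n
    · filter_upwards [hx_step n i] with ω h2 hω
      rw [BlockDR.Pattern.coeff_of_ne_one (e := ε n ω) hω, zero_mul, zero_smul, add_zero] at h2
      change ‖x (n + 1) ω i - z₀.fst i‖ ^ 2 ≤ ‖x n ω i - z₀.fst i‖ ^ 2
      rw [h2]
    · filter_upwards [hy_step n k] with ω h2 hω
      rw [BlockDR.Pattern.coeff_of_ne_one (e := ε n ω) hω, zero_mul, zero_smul, add_zero] at h2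
      change ‖y (n + 1) ω k - z₀.snd k‖ ^ 2 ≤ ‖y n ω k - z₀.snd k‖ ^ 2
      rw [h2]
  -- weak convergence of the governing sequence
  obtain ⟨Z, hZ⟩ := BlockDR.exists_drOp_eq hA hB (L := L) hγ hF
  -- The null set in the Fejér property depends on the fixed point, so only countably many, dense
  -- among the fixed points, are used.
  obtain ⟨D, hDT, hDc, hTD⟩ := (TopologicalSpace.IsSeparable.of_separableSpace
    {z | T z = z}).exists_countable_dense_subset
  have hDne : D.Nonempty := by
    by_contra h
    rw [not_nonempty_iff_eq_empty.1 h, closure_empty] at hTD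
    exact hTD (show Z ∈ {z | T z = z} from hZ)
  have hfejer := (ae_ball_iff hDc).2 fun z hz => BlockDR.ae_fejer_of_random_sweeping ℱ hT (hDT hz)
    hX (fun n => (hμ n).1.le) (fun n => (hμ n).2.le) hEm hr0 hr1 hE hEc hs he0 he hs_sum
    (hon z) (hoff z)
  have hweak : ∀ᵐ ω ∂P, ∃ l, T l = l ∧
      ∀ v, Tendsto (fun n => ⟪X n ω, v⟫_ℝ) atTop (𝓝 ⟪l, v⟫_ℝ) := by
    filter_upwards [hfejer] with ω hω
    refine BlockDR.exists_weak_limit_of_fejer hT.nonexpansive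
      (BlockDR.blockScale (fun i => (P.real (E (Sum.inl i) 0))⁻¹)
        fun k => (P.real (E (Sum.inr k) 0))⁻¹)
      (BlockDR.blockScale_symm _ _) (fun u => ?_) hDne hTD (fun z hz => (hω z hz).1) ?_
    · rw [BlockDR.inner_blockScale_self fun j => (P.real (E j 0))⁻¹, ← BlockDR.sum_blockSq]
      exact Finset.sum_le_sum fun j _ => le_mul_of_one_le_left (BlockDR.blockSq_nonneg _ _)
        ((one_le_inv₀ (hr0 j)).2 (hr1 j))
    · obtain ⟨z, hz⟩ := hDne
      have h1 := (hω z hz).2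
      -- The factors `μ n * (2 - μ n)` are bounded below by `(⨅ n, μ n) * (2 - ⨆ n, μ n)`, which is
      -- positive.
      have h2 : Summable fun n => ‖T (X n ω) - X n ω‖ ^ 2 := by
        refine (h1.mul_left ((⨅ n, μ n) * (2 - ⨆ n, μ n))⁻¹).of_nonneg_of_le
          (fun n => sq_nonneg _) fun n => ?_
        rw [← mul_assoc]
        refine le_mul_of_one_le_left (sq_nonneg _) ?_
        rw [inv_mul_eq_div, one_le_div hδ]
        have := hμ_le n
        have := hle_μ n
        exact mul_le_mul (hμ_le n) (by linarith) (sub_pos.2 hμ_sup).le (hμ n).1.le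
      have h3 := (Real.continuous_sqrt.tendsto 0).comp h2.tendsto_atTop_zero
      simpa [Function.comp_def] using h3
  -- weak convergence of the shadow sequences
  let Q := (BlockDR.graphSubspace L).starProjection
  have hblock : ∀ᵐ ω ∂P, ∃ l, T l = l ∧
      (∀ v, Tendsto (fun n => ⟪z n ω, v⟫_ℝ) atTop (𝓝 ⟪(Q l).fst, v⟫_ℝ)) ∧
      (∀ v, Tendsto (fun n => ⟪w n ω, v⟫_ℝ) atTop (𝓝 ⟪(Q l).snd, v⟫_ℝ)) ∧
      ∀ v, Tendsto (fun n => ⟪y n ω, v⟫_ℝ) atTop (𝓝 ⟪l.snd, v⟫_ℝ) := by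
    filter_upwards [hweak, hc_weak, hd_weak, ae_all_iff.2 fun n => ae_all_iff.2 (hz_step n),
      ae_all_iff.2 fun n => ae_all_iff.2 (hw_step n), ae_all_iff.2 h_io]
      with ω ⟨l, hTl, hl⟩ hcω hdω hzω hwω hio
    rw [BlockDR.weakTendsto_iff_inner] at hcω hdω
    have hκ : ∀ j, ∃ᶠ n in atTop, (ε n ω).coeff j = 1 := fun j =>
      (hio j).mono fun n hn => BlockDR.Pattern.coeff_of_eq_one hn
    have hQl := BlockDR.tendsto_inner_map Q hl
    have hfst : ∀ v, Tendsto (fun n => ⟪(BlockDR.graphProj L (x n ω) (y n ω)).fst, v⟫_ℝ) atTop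
        (𝓝 ⟪(Q l).fst, v⟫_ℝ) :=
      fun v => BlockDR.tendsto_inner_map (WithLp.fstL 2 ℝ (PiLp 2 H) (PiLp 2 G)) hQl v
    have hsnd : ∀ v, Tendsto (fun n => ⟪(BlockDR.graphProj L (x n ω) (y n ω)).snd, v⟫_ℝ) atTop
        (𝓝 ⟪(Q l).snd, v⟫_ℝ) :=
      fun v => BlockDR.tendsto_inner_map (WithLp.sndL 2 ℝ (PiLp 2 H) (PiLp 2 G)) hQl v
    have hy' : ∀ v, Tendsto (fun n => ⟪y n ω, v⟫_ℝ) atTop (𝓝 ⟪l.snd, v⟫_ℝ) :=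
      fun v => BlockDR.tendsto_inner_map (WithLp.sndL 2 ℝ (PiLp 2 H) (PiLp 2 G)) hl v
    have hzl := BlockDR.tendsto_inner_of_block_refresh (z := fun n => z n ω)
      (κ := fun n i => (ε n ω).coeff (Sum.inl i)) (fun i => hκ (Sum.inl i))
      (fun n i => (ε n ω).coeff_eq_zero_or_one _) hzω hfst hcω
    have hwl := BlockDR.tendsto_inner_of_block_refresh (z := fun n => w n ω)
      (κ := fun n k => (ε n ω).coeff (Sum.inr k)) (fun k => hκ (Sum.inr k))
      (fun n k => (ε n ω).coeff_eq_zero_or_one _) hwω hsnd hdω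
    exact ⟨l, hTl, hzl, hwl, hy'⟩
  constructor
  · refine BlockDR.weaklyConvergesTo_of_ae hz hF ?_
    filter_upwards [hblock] with ω ⟨l, hTl, hzl, _, _⟩
    obtain ⟨h1, h2⟩ := BlockDR.dual_pair_of_drOp_eq hA hB hγ hTl
    exact ⟨_, BlockDR.mem_primalSolutions_of_dual_pair h1 h2, hzl⟩
  · have hdual : (BlockDR.dualSolutions A B L).Nonempty := by
      obtain ⟨h1, h2⟩ := BlockDR.dual_pair_of_drOp_eq hA hB hγ hZ
      exact ⟨_, BlockDR.mem_dualSolutions_of_primal_pair h1 h2⟩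
    refine BlockDR.weaklyConvergesTo_of_ae (u := fun n ω => γ⁻¹ • (w n ω - y n ω))
      (fun n => ((hw n).sub (hy n)).const_smul γ⁻¹) hdual ?_
    filter_upwards [hblock] with ω ⟨l, hTl, _, hwl, hyl⟩
    obtain ⟨h1, h2⟩ := BlockDR.dual_pair_of_drOp_eq hA hB hγ hTl
    -- The limit is `γ⁻¹ • ((Q l).snd - l.snd)`, the dual component attached to the fixed point `l`.
    refine ⟨_, BlockDR.mem_dualSolutions_of_primal_pair h1 h2, fun v => ?_⟩
    simp only [real_inner_smul_left, inner_sub_left]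
    exact ((hwl v).sub (hyl v)).const_mul _
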